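/- Let $P$ be a natural unit interval order, i.e. a poset on a finite subset $V$ of the positive integers $\mathbb{P}$ such that (1) $x<_P y$ implies $x<y$, and (2) if $x<_P z$ and $y\in V$ is distinct from and incomparable in $P$ to both $x$ and $z$, then $x<y<z$. Let $G=(V,E)$ be the incomparability graph of $P$: its vertices are the elements of $P$ and its edges are the pairs of distinct incomparable elements. Let $$X_G(\mathbf{x},t)=\sum_{\kappa} t^{\mathrm{asc}(\kappa)}\prod_{v\in V}x_{\kappa(v)},\qquad \mathrm{asc}(\kappa)=\bigl|\{\{i,j\}\in E : i<j,\ \kappa(i)<\kappa(j)\}\bigr|,$$ be its chromatic quasisymmetric function, where $\kappa$ runs over all proper colorings $\kappa:V\to\mathbb{P}$ of $G$. A $P$-tableau $T$ of shape $\lambda(T)=\lambda$ is a filling of the Young diagram of a partition $\lambda$ of $|V|$ (in English notation) with the elements of $P$ such that each element of $P$ appears exactly once, $y>_P x$ whenever $y$ is immediately to the right of $x$, and $y\not<_P x$ whenever $y$ is immediately below $x$. Let $\mathcal{T}_P$ be the set of all $P$-tableaux, and for $T\in\mathcal{T}_P$ let $\mathrm{inv}_G(T)$ be the number of edges $\{i,j\}\in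 E$ such that $i<j$ and $i$ appears in a lower row of $T$ than $j$ (not necessarily in the same column). Then $$X_G(\mathbf{x},t)=\sum_{T\in\mathcal{T}_P}t^{\mathrm{inv}_G(T)}\,s_{\lambda(T)},$$ where $s_\lambda$ denotes the Schur function. Consequently $X_G(\mathbf{x},t)$ is Schur-positive: for every $j\ge 0$, the coefficient of $t^j$ in $X_G(\mathbf{x},t)$ is a linear combination of Schur functions with nonnegative coefficients. -/

import Mathlib

namespace ChromaticQuasi

/-! ### Natural unit interval orders and incomparability graphs -/

/-- Distinct elements `x`, `y` that are incomparable for the strict partial order `lt`. -/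
def Incomp {V : Type*} (lt : V → V → Prop) (x y : V) : Prop :=
  x ≠ y ∧ ¬ lt x y ∧ ¬ lt y x

/-- `lt` is the strict order relation `<_P` of a natural unit interval order `P` on `V`; here `<`
is the ambient ("natural") linear order on `V`. -/
structure IsNaturalUnitIntervalOrder {V : Type*} [LinearOrder V] (lt : V → V → Prop) : Prop where
  irrefl : ∀ x, ¬ lt x x
  trans : ∀ x y z, lt x y → lt y z → lt x z
  /-- `x <_P y` implies `x < y`. -/
  natural : ∀ x y, lt x y → x < y
  /-- If `{x <_P z} + {y}` is an induced subposet of `P`, then `x < y < z`. -/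
  between : ∀ x y z, lt x z → Incomp lt x y → Incomp lt y z → x < y ∧ y < z

/-- The incomparability graph `inc(P)` of the poset with strict order `lt`. -/
def incGraph {V : Type*} (lt : V → V → Prop) : SimpleGraph V where
  Adj := Incomp lt
  symm := ⟨fun _ _ h => ⟨h.1.symm, h.2.2, h.2.1⟩⟩
  loopless := ⟨fun _ h => h.1 rfl⟩

/-! ### Formal power series in `x₁, x₂, …`, the variables being indexed by `ℕ+` -/

/-- The sum of a (possibly infinite) family of formal power series, computed coefficientwise.
It is used below only for families in which each monomial occurs in finitely many members, see
`finite_support_coloring` and `finite_support_ssyt`. -/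
noncomputable def formalSum {ι R : Type*} [CommRing R] (f : ι → MvPowerSeries ℕ+ R) :
    MvPowerSeries ℕ+ R :=
  fun m => ∑ᶠ i, MvPowerSeries.coeff m (f i)

/-- For a finite product of variables, a nonzero coefficient forces each of the variables to
lie in the support of the exponent. -/
theorem mem_support_of_coeff_ne_zero {α R : Type*} [CommRing R] (s : Finset α) (g : α → ℕ+)
    (r : R) (m : ℕ+ →₀ ℕ)
    (h : MvPowerSeries.coeff m (MvPowerSeries.C r * ∏ a ∈ s, MvPowerSeries.X (g a)) ≠ 0)
    (a : α) (ha : a ∈ s) : g a ∈ m.support := by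
  classical
  have key : (∏ a ∈ s, (MvPowerSeries.X (g a) : MvPowerSeries ℕ+ R))
      = MvPowerSeries.monomial (∑ a ∈ s, Finsupp.single (g a) 1) 1 := by
    clear h ha
    induction s using Finset.induction_on with
    | empty => simp
    | insert b s hb ih =>
      rw [Finset.prod_insert hb, Finset.sum_insert hb, ih, MvPowerSeries.X,
        MvPowerSeries.monomial_mul_monomial, one_mul]
  rw [key, MvPowerSeries.coeff_C_mul, MvPowerSeries.coeff_monomial] at h
  have hm : m = ∑ a ∈ s, Finsupp.single (g a) 1 := by
    by_contra hne
    simp [hne] at h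
  rw [hm, Finsupp.mem_support_iff, Finsupp.finsetSum_apply]
  have h1 : Finsupp.single (g a) 1 (g a) ≤ ∑ b ∈ s, (Finsupp.single (g b) 1 : ℕ+ →₀ ℕ) (g a) :=
    Finset.single_le_sum (f := fun b => (Finsupp.single (g b) 1 : ℕ+ →₀ ℕ) (g a))
      (fun _ _ => Nat.zero_le _) ha
  rw [Finsupp.single_eq_same] at h1
  omega

/-! ### Chromatic quasisymmetric functions -/

open Classical in
/-- `asc(κ)`: the number of edges `{i, j}` with `i < j` and `κ(i) < κ(j)`. -/
noncomputable def asc {V : Type*} [Fintype V] [LinearOrder V] (G : SimpleGraph V) (κ : V → ℕ+) :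
    ℕ :=
  (Finset.univ.filter fun p : V × V => G.Adj p.1 p.2 ∧ p.1 < p.2 ∧ κ p.1 < κ p.2).card

/-- The term `t ^ asc(κ) * x_κ`; here `t` is the variable of `ℤ[t]`, and `x_κ = ∏ v, x_{κ(v)}`. -/
noncomputable def coloringTerm {V : Type*} [Fintype V] [LinearOrder V] (G : SimpleGraph V)
    (κ : G.Coloring ℕ+) : MvPowerSeries ℕ+ (Polynomial ℤ) :=
  MvPowerSeries.C (Polynomial.X ^ asc G κ) * ∏ v : V, MvPowerSeries.X (κ v)

/-- The chromatic quasisymmetric function `X_G(x, t) = ∑_κ t ^ asc(κ) * x_κ`, the sum being over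
all proper colorings `κ : V → ℕ+` of `G`. -/
noncomputable def chromaticQuasisymmetric {V : Type*} [Fintype V] [LinearOrder V]
    (G : SimpleGraph V) : MvPowerSeries ℕ+ (Polynomial ℤ) :=
  formalSum (coloringTerm G)

theorem finite_support_coloring {V : Type*} [Fintype V] [LinearOrder V] (G : SimpleGraph V)
    (m : ℕ+ →₀ ℕ) :
    (Function.support fun κ => MvPowerSeries.coeff m (coloringTerm G κ)).Finite := by
  have hfin : {f : V → ℕ+ | ∀ v, f v ∈ m.support}.Finite := by
    have := Set.Finite.pi (fun _ : V => m.support.finite_toSet)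
    refine this.subset fun f hf => ?_
    simpa [Set.mem_pi] using hf
  refine Set.Finite.of_finite_image (f := fun κ : G.Coloring ℕ+ => (κ : V → ℕ+))
    (hfin.subset ?_) (DFunLike.coe_injective.injOn)
  rintro _ ⟨κ, hκ, rfl⟩ v
  exact mem_support_of_coeff_ne_zero Finset.univ (fun v => κ v) _ m hκ v (Finset.mem_univ v)

/-! ### Schur functions -/

/-- The monomial of a semistandard tableau `T`. Mathlib's semistandard tableaux have entries in
`{0, 1, 2, …}`, so an entry `k` of it stands for the entry `k + 1` and contributes `x_{k+1}`. -/
noncomputable def ssytTerm (μ : YoungDiagram) (T : SemistandardYoungTableau μ) :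
    MvPowerSeries ℕ+ ℤ :=
  ∏ c ∈ μ.cells, MvPowerSeries.X (T c.1 c.2).succPNat

/-- The Schur function `s_μ`, the sum of the monomials of all semistandard tableaux of shape `μ`. -/
noncomputable def schur (μ : YoungDiagram) : MvPowerSeries ℕ+ ℤ :=
  formalSum (ssytTerm μ)

theorem finite_support_ssyt (μ : YoungDiagram) (m : ℕ+ →₀ ℕ) :
    (Function.support fun T => MvPowerSeries.coeff m (ssytTerm μ T)).Finite := by
  have hfin : {f : μ.cells → ℕ+ | ∀ c, f c ∈ m.support}.Finite := by
    have := Set.Finite.pi (fun _ : μ.cells => m.support.finite_toSet)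
    refine this.subset fun f hf => ?_
    simpa [Set.mem_pi] using hf
  refine Set.Finite.of_finite_image
    (f := fun (T : SemistandardYoungTableau μ) (c : μ.cells) => (T c.1.1 c.1.2).succPNat)
    (hfin.subset ?_) ?_
  · rintro _ ⟨T, hT, rfl⟩ c
    refine mem_support_of_coeff_ne_zero μ.cells (fun c => (T c.1 c.2).succPNat) (1 : ℤ) m ?_ c.1 c.2
    rw [map_one, one_mul]
    exact hT
  · intro T _ T' _ h
    ext i j
    by_cases hc : (i, j) ∈ μ
    · have := congrFun h ⟨(i, j), (YoungDiagram.mem_cells _).2 hc⟩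
      exact Nat.succPNat_injective this
    · rw [T.zeros hc, T'.zeros hc]

/-- `f` is Schur-positive: a finite linear combination of Schur functions with nonnegative
coefficients. -/
def SchurPositive (f : MvPowerSeries ℕ+ ℤ) : Prop :=
  ∃ c : YoungDiagram →₀ ℤ, (∀ μ, 0 ≤ c μ) ∧ f = c.sum fun μ a => a • schur μ

/-- The coefficient `a_j(x)` of `t ^ j` in `f(x, t) = ∑_j a_j(x) t ^ j`. -/
noncomputable def tCoeff (j : ℕ) (f : MvPowerSeries ℕ+ (Polynomial ℤ)) : MvPowerSeries ℕ+ ℤ :=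
  fun m => (MvPowerSeries.coeff m f).coeff j

/-! ### `P`-tableaux -/

/-- A `P`-tableau, for the poset `P` on `V` with strict order `lt`: a filling of a Young diagram
(English notation, the cell `(i, j)` lying in row `i` and column `j`) in which each element of `P`
appears exactly once. -/
structure PTableau {V : Type*} (lt : V → V → Prop) where
  shape : YoungDiagram
  entry : {c : ℕ × ℕ // c ∈ shape} ≃ V
  /-- If `y` is immediately to the right of `x`, then `x <_P y`. -/
  row : ∀ c d : {c : ℕ × ℕ // c ∈ shape}, d.1 = (c.1.1, c.1.2 + 1) → lt (entry c) (entry d)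
  /-- If `y` is immediately below `x`, then `y ≮_P x`. -/
  col : ∀ c d : {c : ℕ × ℕ // c ∈ shape}, d.1 = (c.1.1 + 1, c.1.2) → ¬ lt (entry d) (entry c)

namespace PTableau

/-- The row of `T` in which `v` appears (rows are numbered from the top). -/
def rowOf {V : Type*} {lt : V → V → Prop} (T : PTableau lt) (v : V) : ℕ := (T.entry.symm v).1.1

open Classical in
/-- `inv_G(T)` for `G = inc(P)`: the number of edges `{i, j}` of `G` such that `i < j` and `i`
appears below `j` (in a lower row, not necessarily in the same column). -/
noncomputable def inv {V : Type*} [Fintype V] [LinearOrder V] {lt : V → V → Prop}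
    (T : PTableau lt) : ℕ :=
  (Finset.univ.filter fun p : V × V =>
    (incGraph lt).Adj p.1 p.2 ∧ p.1 < p.2 ∧ T.rowOf p.2 < T.rowOf p.1).card

instance finite {V : Type*} [Finite V] (lt : V → V → Prop) : Finite (PTableau lt) := by
  classical
  have hpos : ∀ (T : PTableau lt) (v : V),
      (T.entry.symm v).1 ∈ (Finset.range (Nat.card V) ×ˢ Finset.range (Nat.card V)) := by
    intro T v
    obtain ⟨⟨i, j⟩, hc⟩ := T.entry.symm v
    have hcard : Nat.card V = T.shape.cells.card := by
      rw [← Nat.card_congr T.entry]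
      exact Nat.card_eq_card_finite_toFinset (s := (T.shape : Set (ℕ × ℕ))) T.shape.cells.finite_toSet
        |>.trans (by congr 1; ext; simp)
    have h1 : i < T.shape.colLen j := YoungDiagram.mem_iff_lt_colLen.1 hc
    have h2 : j < T.shape.rowLen i := YoungDiagram.mem_iff_lt_rowLen.1 hc
    have h3 : T.shape.colLen j ≤ T.shape.cells.card := by
      rw [YoungDiagram.colLen_eq_card]
      exact Finset.card_le_card (Finset.filter_subset _ _)
    have h4 : T.shape.rowLen i ≤ T.shape.cells.card := by
      rw [YoungDiagram.rowLen_eq_card]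
      exact Finset.card_le_card (Finset.filter_subset _ _)
    simp only [Finset.mem_product, Finset.mem_range]
    omega
  let F : PTableau lt → V → (Finset.range (Nat.card V) ×ˢ Finset.range (Nat.card V) : Finset _) :=
    fun T v => ⟨(T.entry.symm v).1, hpos T v⟩
  refine Finite.of_injective F fun T T' h => ?_
  have hp : ∀ v, (T.entry.symm v).1 = (T'.entry.symm v).1 := fun v =>
    congrArg Subtype.val (congrFun h v)
  obtain ⟨μ, e, r, c⟩ := T
  obtain ⟨μ', e', r', c'⟩ := T'
  simp only at hp
  have hμ : μ = μ' := by
    refine SetLike.ext fun x => ⟨fun hx => ?_, fun hx => ?_⟩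
    · have := hp (e ⟨x, hx⟩)
      rw [Equiv.symm_apply_apply] at this
      simp only at this
      rw [this]
      exact (e'.symm _).2
    · have := hp (e' ⟨x, hx⟩)
      rw [Equiv.symm_apply_apply] at this
      simp only at this
      rw [← this]
      exact (e.symm _).2
  subst hμ
  have he : e = e' := by
    have : e.symm = e'.symm := Equiv.ext fun v => Subtype.ext (hp v)
    simpa using congrArg Equiv.symm this
  subst he
  rfl

noncomputable instance {V : Type*} [Finite V] (lt : V → V → Prop) : Fintype (PTableau lt) :=
  Fintype.ofFinite _

end PTableau

end ChromaticQuasi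

/-! The expansion is first proved with finitely many colors `0, …, n - 1`, by a Gasharov-style
cancellation that keeps track of `t`. Write `a_e` for the determinant of the `x_i ^ (e_j + n - 1 -
j)`. The bialternant formula `alternant_eq_mul_schurPoly` says `a_λ = a_0 s_λ`, and `a_0` is a
Vandermonde determinant, so it is enough to expand `a_0 X_G` in the `a_λ`.

The engine is `sum_des_comm`. In a natural unit interval order, an edge `i < k` makes every `j`
strictly between them adjacent to both. A graph properly colored by two colors has no triangle, so
two color classes induce a disjoint union of increasing paths. On a path with an even number of
vertices the two classes have equal size. On an odd one, the two colorings have exchanged class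
sizes and equally many descents. Hence recoloring a union of components by two adjacent colors lets
the class sizes be exchanged in any sum weighted by `t ^ des`.

This is used twice. Applied to all vertices of two adjacent colors, it shows that the generating
function is symmetric, and expanding `a_0` then gives `a_0 X_G = ∑_κ t ^ des(κ) a_{type(κ)}`
(`alternant_zero_mul_desSum`). Now read the color classes as left-justified rows. A coloring fails
to be a `P`-tableau exactly when it has a flaw. Applied to the part of two adjacent rows lying above
the first flaw in the order `P`, the exchange interchanges two columns of the alternant, so the
flawed colorings sum to zero (`sum_exists_flaw_eq_zero`). The flawless ones are the tableaux, with
`des` becoming `inv` (`sum_flawless_eq`).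

Reversing the colors turns descents into ascents. A fixed monomial involves finitely many variables,
so comparing coefficients gives the identity of power series. Schur-positivity is then read off from
the powers of `t`. -/

namespace ChromaticQuasi

/-! ### The bialternant formula for semistandard tableaux with bounded entries -/

section Bialternant

variable {R : Type*} [CommRing R]

/-- Subtracting multiples of adjacent columns from a generalized Vandermonde determinant and
expanding along the first row. -/
theorem det_pow_succ {n : ℕ} (y : Fin (n + 1) → R) (l : Fin (n + 1) → ℕ)
    (hl : ∀ j : Fin n, l j.castSucc ≤ l j.succ) :
    (Matrix.of fun i j => y i ^ l j).det =
      y 0 ^ l 0 * (∏ i : Fin n, (y i.succ - y 0)) *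
        ∑ k ∈ Fintype.piFinset fun j : Fin n => Finset.Ico (l j.castSucc) (l j.succ),
          (∏ j, y 0 ^ (l j.succ - 1 - k j)) * (Matrix.of fun i j => y i.succ ^ k j).det := by
  classical
  -- The multiplier `y 0 ^ (l j.succ - l j.castSucc)` clears every entry of row `0` except the
  -- first.
  let B : Matrix (Fin (n + 1)) (Fin (n + 1)) R := Matrix.of fun i j =>
    Fin.cases (motive := fun _ => R) (y i ^ l 0)
      (fun j => y i ^ l j.succ - y 0 ^ (l j.succ - l j.castSucc) * y i ^ l j.castSucc) j
  rw [Matrix.det_eq_of_forall_col_eq_smul_add_pred (A := Matrix.of fun i j => y i ^ l j) (B := B)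
    (fun j => y 0 ^ (l j.succ - l j.castSucc)) (fun i => rfl) (fun i j => by simp [B])]
  rw [Matrix.det_succ_row_zero, Fin.sum_univ_succ, Finset.sum_eq_zero, add_zero]
  -- Each remaining entry is divisible by `y i.succ - y 0`. The quotient is a geometric sum, which
  -- multilinearity in the columns then splits.
  · have hB : B.submatrix Fin.succ (Fin.succAbove 0) = Matrix.of fun i j =>
        (y i.succ - y 0) * (Matrix.of fun i j => ∑ k ∈ Finset.Ico (l (Fin.castSucc j)) (l j.succ),
          y 0 ^ (l j.succ - 1 - k) * y (Fin.succ i) ^ k : Matrix (Fin n) (Fin n) R) i j := by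
      ext i j
      have := (Commute.all (y i.succ) (y 0)).mul_geom_sum₂_Ico (hl j)
      simp only [B, Matrix.submatrix_apply, Matrix.of_apply, Fin.zero_succAbove, Fin.cases_succ]
      rw [mul_comm (y 0 ^ _), ← mul_comm (_ ^ _), mul_comm (y 0 ^ _), ← this]
      congr 1
      refine Finset.sum_congr rfl fun k _ => ?_
      rw [mul_comm]
    rw [hB, Matrix.det_mul_column]
    have hdet : (Matrix.of fun i j => ∑ k ∈ Finset.Ico (l (Fin.castSucc j)) (l j.succ),
          y 0 ^ (l j.succ - 1 - k) * y (Fin.succ i) ^ k : Matrix (Fin n) (Fin n) R).det =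
        ∑ k ∈ Fintype.piFinset fun j : Fin n => Finset.Ico (l j.castSucc) (l j.succ),
          (∏ j, y 0 ^ (l j.succ - 1 - k j)) * (Matrix.of fun i j => y i.succ ^ k j).det := by
      rw [← Matrix.det_transpose]
      have h1 : (Matrix.of fun i j => ∑ k ∈ Finset.Ico (l (Fin.castSucc j)) (l j.succ),
          y 0 ^ (l j.succ - 1 - k) * y (Fin.succ i) ^ k : Matrix (Fin n) (Fin n) R).transpose =
          fun j => ∑ k ∈ Finset.Ico (l (Fin.castSucc j)) (l j.succ),
            fun i => y 0 ^ (l j.succ - 1 - k) * y (Fin.succ i) ^ k := by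
        ext j i
        simp [Finset.sum_apply]
      rw [h1]
      refine ((Matrix.detRowAlternating (R := R) (n := Fin n)).toMultilinearMap.map_sum_finset
        (fun j k => fun i => y 0 ^ (l j.succ - 1 - k) * y (Fin.succ i) ^ k) _).trans ?_
      refine Finset.sum_congr rfl fun k _ => ?_
      rw [← Matrix.det_transpose (Matrix.of fun i j => y (Fin.succ i) ^ k j),
        ← Matrix.det_mul_column]
      rfl
    rw [hdet]
    simp [B]
    ring
  · intro j _
    have : B 0 j.succ = 0 := by
      simp only [B, Matrix.of_apply, Fin.cases_succ]
      rw [← pow_add, Nat.sub_add_cancel (hl j), sub_self]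
    rw [this]
    ring

/-- The alternant `det (x_i ^ (e_j + n - 1 - j))`. -/
noncomputable def alternant {n : ℕ} (x : ℕ → R) (e : Fin n → ℕ) : R :=
  (Matrix.of fun i j : Fin n => x i ^ (e j + (n - 1 - j))).det

/-- Rows and columns are reversed by the same permutation, so no sign appears. For antitone `e` the
exponents now increase, as `det_pow_succ` needs. -/
theorem alternant_eq_det_rev {n : ℕ} (x : ℕ → R) (e : Fin n → ℕ) :
    alternant x e = (Matrix.of fun i j : Fin n => x i.rev ^ (e j.rev + j)).det := by
  rw [alternant, ← Matrix.det_submatrix_equiv_self Fin.revPerm]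
  congr 1
  ext i j
  simp only [Matrix.submatrix_apply, Matrix.of_apply, Fin.revPerm_apply, Fin.val_rev]
  congr 2
  omega

/-- Up to the factor `∏ (x i - x n)`, alternants obey the branching rule of Schur polynomials
(`schurPoly_succ`). The exponents chosen in `det_pow_succ` become the sequences `e'` interlacing `e`
once the staircase is subtracted. -/
theorem alternant_succ {n : ℕ} (x : ℕ → R) (e : Fin (n + 1) → ℕ) (he : Antitone e) :
    alternant x e = (∏ i : Fin n, (x i - x n)) *
      ∑ e' ∈ Fintype.piFinset fun j : Fin n => Finset.Icc (e j.succ) (e j.castSucc),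
        x n ^ (e (Fin.last n) + ∑ j, (e j.castSucc - e' j)) * alternant x e' := by
  rw [alternant_eq_det_rev, det_pow_succ (fun i : Fin (n + 1) => x i.rev)
    (fun j => e j.rev + j)
    (fun j => add_le_add (he (Fin.rev_le_rev.2 (Fin.castSucc_lt_succ).le)) (by simp))]
  have hP : ∏ i : Fin n, (x (Fin.rev i.succ) - x (Fin.rev (0 : Fin (n + 1)))) =
      ∏ i : Fin n, (x i - x n) := by
    rw [← Equiv.prod_comp Fin.revPerm]
    refine Finset.prod_congr rfl fun i _ => ?_
    simp [Fin.rev_succ]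
  rw [hP, mul_comm (_ ^ _), mul_assoc, Finset.mul_sum]
  congr 1
  refine Finset.sum_bij' (fun k _ j => k j.rev - (n - 1 - j)) (fun e' _ j => e' j.rev + j)
    ?_ ?_ ?_ ?_ ?_
  · intro k hk
    simp only [Fintype.mem_piFinset, Finset.mem_Ico, Finset.mem_Icc] at hk ⊢
    intro j
    have := hk j.rev
    rw [Fin.rev_castSucc, Fin.rev_succ, Fin.rev_rev] at this
    simp only [Fin.val_succ, Fin.val_castSucc, Fin.val_rev] at this
    omega
  · intro k hk
    simp only [Fintype.mem_piFinset, Finset.mem_Ico, Finset.mem_Icc] at hk ⊢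
    intro j
    have := hk j.rev
    rw [Fin.rev_castSucc, Fin.rev_succ]
    simp only [Fin.val_succ, Fin.val_castSucc]
    omega
  · intro k hk
    simp only [Fintype.mem_piFinset, Finset.mem_Ico] at hk
    ext j
    have := hk j
    simp only [Fin.val_castSucc, Fin.rev_rev, Fin.val_rev] at this ⊢
    omega
  · intro k hk
    ext j
    simp only [Fin.rev_rev, Fin.val_rev]
    omega
  · intro k hk
    simp only [Fintype.mem_piFinset, Finset.mem_Ico] at hk
    rw [← mul_assoc]
    congr 1
    · rw [Finset.prod_pow_eq_pow_sum, ← pow_add]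
      simp only [Fin.rev_zero, Fin.val_last, Fin.val_zero, add_zero]
      congr 2
      rw [← Equiv.sum_comp Fin.revPerm]
      refine Finset.sum_congr rfl fun j _ => ?_
      have := hk j.rev
      rw [Fin.rev_castSucc, Fin.rev_succ, Fin.rev_rev] at this
      simp only [Fin.revPerm_apply, Fin.rev_succ, Fin.rev_rev, Fin.val_succ, Fin.val_castSucc,
        Fin.val_rev] at this ⊢
      omega
    · rw [alternant_eq_det_rev]
      congr 1
      ext i j
      have := hk j
      simp only [Matrix.of_apply, Fin.rev_succ, Fin.val_castSucc, Fin.rev_rev, Fin.val_rev]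
        at this ⊢
      congr 1
      omega

theorem finite_ssyt_lt (n : ℕ) (μ : YoungDiagram) :
    {T : SemistandardYoungTableau μ | ∀ c ∈ μ.cells, T c.1 c.2 < n}.Finite := by
  refine Set.Finite.of_finite_image
    (f := fun (T : SemistandardYoungTableau μ) (c : μ.cells) => T c.1.1 c.1.2)
    ((Set.Finite.pi' fun _ : μ.cells => Set.finite_Iio n).subset ?_) ?_
  · rintro _ ⟨T, hT, rfl⟩ c
    exact hT c.1 c.2
  · intro T _ T' _ h
    ext i j
    by_cases hc : (i, j) ∈ μ
    · exact congrFun h ⟨(i, j), (YoungDiagram.mem_cells _).2 hc⟩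
    · rw [T.zeros hc, T'.zeros hc]

/-- The semistandard tableaux of shape `μ` with entries in `{0, …, n - 1}`. -/
noncomputable def ssytLT (n : ℕ) (μ : YoungDiagram) : Finset (SemistandardYoungTableau μ) :=
  (finite_ssyt_lt n μ).toFinset

theorem mem_ssytLT {n : ℕ} {μ : YoungDiagram} {T : SemistandardYoungTableau μ} :
    T ∈ ssytLT n μ ↔ ∀ c ∈ μ, T c.1 c.2 < n := by
  simp [ssytLT]

/-- The Schur polynomial `s_μ(x_0, …, x_{n-1})`. -/
noncomputable def schurPoly (n : ℕ) (μ : YoungDiagram) (x : ℕ → R) : R :=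
  ∑ T ∈ ssytLT n μ, ∏ c ∈ μ.cells, x (T c.1 c.2)

/-- The Young diagram with row lengths `e`, when `e` is weakly decreasing. -/
def rowDiagram {n : ℕ} (e : Fin n → ℕ) : YoungDiagram where
  -- The sum is only a bound on the columns. Quantifying over all rows up to `c.1` gives a lower set
  -- even when `e` is not antitone.
  cells := (Finset.range n ×ˢ Finset.range (∑ i, e i)).filter fun c =>
    c.1 < n ∧ ∀ i : Fin n, (i : ℕ) ≤ c.1 → c.2 < e i
  isLowerSet := by
    rintro ⟨a, b⟩ ⟨c, d⟩ ⟨h1, h2⟩ h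
    simp only [Finset.coe_filter, Finset.mem_product, Finset.mem_range, Set.mem_ofPred_eq] at *
    exact ⟨⟨by omega, by omega⟩, by omega, fun i hi => (h.2.2 i (hi.trans h1)).trans_le' h2⟩

theorem mem_rowDiagram {n : ℕ} {e : Fin n → ℕ} (he : Antitone e) {i j : ℕ} :
    (i, j) ∈ rowDiagram e ↔ ∃ h : i < n, j < e ⟨i, h⟩ := by
  rw [← YoungDiagram.mem_cells]
  simp only [rowDiagram, Finset.mem_filter, Finset.mem_product, Finset.mem_range]
  constructor
  · exact fun h => ⟨h.2.1, h.2.2 ⟨i, h.2.1⟩ le_rfl⟩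
  · rintro ⟨h, hj⟩
    exact ⟨⟨h, hj.trans_le (Finset.single_le_sum (fun _ _ => Nat.zero_le _) (Finset.mem_univ _))⟩,
      h, fun k hk => hj.trans_le (he (by exact hk))⟩

theorem card_rowDiagram {n : ℕ} {e : Fin n → ℕ} (he : Antitone e) :
    (rowDiagram e).cells.card = ∑ i, e i := by
  have : (rowDiagram e).cells =
      (Finset.univ.sigma fun i : Fin n => Finset.range (e i)).map
        ⟨fun p => ((p.1 : ℕ), p.2), by
          rintro ⟨a, b⟩ ⟨c, d⟩ h
          simp only [Prod.mk.injEq, Fin.val_inj] at h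
          obtain ⟨rfl, rfl⟩ := h
          rfl⟩ := by
    ext ⟨i, j⟩
    rw [YoungDiagram.mem_cells, mem_rowDiagram he]
    simp only [Finset.mem_map, Finset.mem_sigma, Finset.mem_univ, Finset.mem_range, true_and,
      Sigma.exists]
    constructor
    · rintro ⟨h, hj⟩
      exact ⟨⟨i, h⟩, j, hj, rfl⟩
    · rintro ⟨a, b, hb, h⟩
      obtain ⟨rfl, rfl⟩ := Prod.mk.inj h
      exact ⟨a.2, hb⟩
  rw [this]
  simp

theorem le_ssyt_entry {μ : YoungDiagram} (T : SemistandardYoungTableau μ) {i j : ℕ}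
    (h : (i, j) ∈ μ) : i ≤ T i j := by
  induction i with
  | zero => exact Nat.zero_le _
  | succ i ih =>
    have := T.col_strict (Nat.lt_add_one i) h
    have := ih (μ.up_left_mem (Nat.le_succ i) le_rfl h)
    omega

/-- Strict columns force an entry in row `n` to be at least `n`. -/
theorem schurPoly_eq_zero {n : ℕ} {μ : YoungDiagram} (h : (n, 0) ∈ μ) (x : ℕ → R) :
    schurPoly n μ x = 0 := by
  rw [schurPoly, Finset.sum_eq_zero]
  intro T hT
  exact absurd (mem_ssytLT.1 hT _ h) (not_lt.2 (le_ssyt_entry T h))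

/-- The cells of a semistandard tableau whose entries are less than `n`. -/
def subDiagram {μ : YoungDiagram} (T : SemistandardYoungTableau μ) (n : ℕ) : YoungDiagram where
  cells := μ.cells.filter fun c => T c.1 c.2 < n
  isLowerSet := by
    rintro ⟨a, b⟩ ⟨c, d⟩ ⟨h1, h2⟩ h
    simp only [Finset.coe_filter, YoungDiagram.mem_cells, Set.mem_ofPred_eq] at *
    have h3 : (a, d) ∈ μ := μ.up_left_mem le_rfl h2 h.1
    exact ⟨μ.up_left_mem h1 h2 h.1,
      ((T.col_weak h1 h3).trans (T.row_weak_of_le h2 h.1)).trans_lt h.2⟩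

theorem mem_subDiagram {μ : YoungDiagram} {T : SemistandardYoungTableau μ} {n i j : ℕ} :
    (i, j) ∈ subDiagram T n ↔ (i, j) ∈ μ ∧ T i j < n := by
  rw [← YoungDiagram.mem_cells]
  simp [subDiagram]

open Classical in
/-- The branching rule for semistandard tableaux. -/
theorem schurPoly_succ {n : ℕ} {e : Fin (n + 1) → ℕ} (he : Antitone e) (x : ℕ → R) :
    schurPoly (n + 1) (rowDiagram e) x =
      ∑ e' ∈ Fintype.piFinset fun j : Fin n => Finset.Icc (e j.succ) (e j.castSucc),
        x n ^ (e (Fin.last n) + ∑ j, (e j.castSucc - e' j)) * schurPoly n (rowDiagram e') x := by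
  have hmem : ∀ T ∈ ssytLT (n + 1) (rowDiagram e),
      (fun j : Fin n => (subDiagram T n).rowLen j) ∈
        Fintype.piFinset fun j : Fin n => Finset.Icc (e j.succ) (e j.castSucc) := by
    intro T hT
    rw [mem_ssytLT] at hT
    simp only [Fintype.mem_piFinset, Finset.mem_Icc]
    intro j
    constructor
    -- An entry of row `j + 1` is at most `n`, so the entry just above it is less than `n`. This is
    -- the lower interlacing bound.
    · refine le_of_forall_lt fun c hc => ?_
      rw [← YoungDiagram.mem_iff_lt_rowLen, mem_subDiagram]
      have h1 : ((j : ℕ) + 1, c) ∈ rowDiagram e := (mem_rowDiagram he).2 ⟨j.succ.2, hc⟩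
      refine ⟨YoungDiagram.up_left_mem _ (Nat.le_succ _) le_rfl h1, ?_⟩
      have h2 := T.col_strict (Nat.lt_add_one (j : ℕ)) h1
      have h3 := hT _ h1
      simp only at h3
      omega
    · refine le_of_forall_lt fun c hc => ?_
      rw [← YoungDiagram.mem_iff_lt_rowLen, mem_subDiagram, mem_rowDiagram he] at hc
      exact hc.1.2
  rw [schurPoly, ← Finset.sum_fiberwise_of_maps_to hmem]
  refine Finset.sum_congr rfl fun e' he' => ?_
  simp only [Fintype.mem_piFinset, Finset.mem_Icc] at he'
  have ha : Antitone e' := by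
    intro i j hij
    rcases hij.eq_or_lt with rfl | hij
    · exact le_rfl
    · exact (he' j).2.trans ((he (by exact hij)).trans (he' i).1)
  have hsub : ∀ {i j}, (i, j) ∈ rowDiagram e' → (i, j) ∈ rowDiagram e := by
    intro i j h
    obtain ⟨hi, hj⟩ := (mem_rowDiagram ha).1 h
    exact (mem_rowDiagram he).2 ⟨by omega, hj.trans_le (he' ⟨i, hi⟩).2⟩
  have hfib : ∀ {T}, T ∈ ssytLT (n + 1) (rowDiagram e) →
      (fun j : Fin n => (subDiagram T n).rowLen j) = e' → ∀ {i j}, (i, j) ∈ rowDiagram e →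
        ((i, j) ∈ rowDiagram e' ↔ T i j < n) := by
    intro T hT hTe i j hij
    rw [mem_rowDiagram ha]
    constructor
    · rintro ⟨hi, hj⟩
      rw [← hTe] at hj
      exact (mem_subDiagram.1 (YoungDiagram.mem_iff_lt_rowLen.2 hj)).2
    · intro h
      have hi : i < n := (le_ssyt_entry T hij).trans_lt h
      refine ⟨hi, ?_⟩
      rw [← hTe]
      exact YoungDiagram.mem_iff_lt_rowLen.1 (mem_subDiagram.2 ⟨hij, h⟩)
  rw [schurPoly, Finset.mul_sum]
  -- Erase the entries equal to `n`; conversely, fill the cells outside `rowDiagram e'` with `n`.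
  -- Interlacing ensures that no column receives `n` twice.
  refine Finset.sum_bij'
    (fun T _ => (⟨fun i j => if (i, j) ∈ rowDiagram e' then T i j else 0, ?_, ?_, ?_⟩ :
      SemistandardYoungTableau (rowDiagram e')))
    (fun T _ => (⟨fun i j => if (i, j) ∈ rowDiagram e' then T i j else
      if (i, j) ∈ rowDiagram e then n else 0, ?_, ?_, ?_⟩ :
      SemistandardYoungTableau (rowDiagram e))) ?_ ?_ ?_ ?_ ?_
  · intro i j1 j2 hj h
    rw [if_pos h, if_pos (YoungDiagram.up_left_mem _ le_rfl hj.le h)]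
    exact T.row_weak hj (hsub h)
  · intro i1 i2 j hi h
    rw [if_pos h, if_pos (YoungDiagram.up_left_mem _ hi.le le_rfl h)]
    exact T.col_strict hi (hsub h)
  · intro i j h
    rw [if_neg h]
  · rename_i hT
    intro i j1 j2 hj h
    rw [if_pos h, if_pos (YoungDiagram.up_left_mem _ le_rfl hj.le h)]
    by_cases h2 : (i, j2) ∈ rowDiagram e'
    · rw [if_pos h2, if_pos (YoungDiagram.up_left_mem _ le_rfl hj.le h2)]
      exact T.row_weak hj h2
    · rw [if_neg h2]
      split_ifs with h1
      · exact (mem_ssytLT.1 hT _ h1).le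
      · exact le_rfl
  · rename_i hT
    intro i1 i2 j hi h
    by_cases h2 : (i2, j) ∈ rowDiagram e'
    · rw [if_pos h2, if_pos (YoungDiagram.up_left_mem _ hi.le le_rfl h2)]
      exact T.col_strict hi h2
    · obtain ⟨hi2, hj⟩ := (mem_rowDiagram he).1 h
      have h1 : (i1, j) ∈ rowDiagram e' := by
        refine (mem_rowDiagram ha).2 ⟨by omega, ?_⟩
        refine lt_of_lt_of_le hj ((he ?_).trans (he' ⟨i1, by omega⟩).1)
        exact Fin.mk_le_mk.2 (by simpa using hi)
      rw [if_pos h1, if_neg h2, if_pos h]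
      exact mem_ssytLT.1 hT _ h1
  · intro i j h
    rw [if_neg (fun h' => h (hsub h')), if_neg h]
  · intro T hT
    rw [Finset.mem_filter] at hT
    rw [mem_ssytLT]
    rintro ⟨i, j⟩ h
    change (if (i, j) ∈ rowDiagram e' then T i j else 0) < n
    rw [if_pos h]
    exact (hfib hT.1 hT.2 (hsub h)).1 h
  · intro T hT
    rw [Finset.mem_filter, mem_ssytLT]
    constructor
    · rintro ⟨i, j⟩ h
      change (if (i, j) ∈ rowDiagram e' then T i j else
        if (i, j) ∈ rowDiagram e then n else 0) < n + 1
      split_ifs with h1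
      · exact (mem_ssytLT.1 hT _ h1).trans (Nat.lt_succ_self n)
      · exact Nat.lt_succ_self n
    · ext j
      refine eq_of_forall_lt_iff fun c => ?_
      rw [← YoungDiagram.mem_iff_lt_rowLen, mem_subDiagram]
      change (_ ∧ (if ((j : ℕ), c) ∈ rowDiagram e' then T j c else
        if ((j : ℕ), c) ∈ rowDiagram e then n else 0) < n) ↔ _
      have h0 : c < e' j ↔ ((j : ℕ), c) ∈ rowDiagram e' := by
        rw [mem_rowDiagram ha]
        exact ⟨fun h => ⟨j.2, h⟩, fun h => h.2⟩
      rw [h0]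
      constructor
      · rintro ⟨h1, h2⟩
        by_contra h3
        rw [if_neg h3, if_pos h1] at h2
        exact lt_irrefl _ h2
      · intro h
        refine ⟨hsub h, ?_⟩
        rw [if_pos h]
        exact mem_ssytLT.1 hT _ h
  · intro T hT
    rw [Finset.mem_filter] at hT
    ext i j
    change (if (i, j) ∈ rowDiagram e' then (if (i, j) ∈ rowDiagram e' then T i j else 0) else
        if (i, j) ∈ rowDiagram e then n else 0) = T i j
    split_ifs with h1 h2
    · rfl
    · have h3 := mt (hfib hT.1 hT.2 h2).2 h1
      have h4 := mem_ssytLT.1 hT.1 _ h2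
      simp only at h4
      omega
    · rw [T.zeros h2]
  · intro T hT
    ext i j
    change (if (i, j) ∈ rowDiagram e' then (if (i, j) ∈ rowDiagram e' then T i j else
        if (i, j) ∈ rowDiagram e then n else 0) else 0) = T i j
    split_ifs with h1
    · rfl
    · rw [T.zeros h1]
  · intro T hT
    rw [Finset.mem_filter] at hT
    have hsub' : (rowDiagram e').cells ⊆ (rowDiagram e).cells := fun c hc => by
      rw [YoungDiagram.mem_cells] at *
      exact hsub hc
    rw [← Finset.prod_sdiff hsub']
    congr 1
    · rw [Finset.prod_congr rfl (g := fun _ => x n), Finset.prod_const,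
        Finset.card_sdiff_of_subset hsub', card_rowDiagram he, card_rowDiagram ha,
        Fin.sum_univ_castSucc]
      · congr 1
        rw [Finset.sum_tsub_distrib _ fun j _ => (he' j).2]
        have : ∑ j, e' j ≤ ∑ j : Fin n, e j.castSucc := Finset.sum_le_sum fun j _ => (he' j).2
        omega
      · rintro ⟨i, j⟩ hc
        rw [Finset.mem_sdiff, YoungDiagram.mem_cells, YoungDiagram.mem_cells] at hc
        have h3 := mt (hfib hT.1 hT.2 hc.1).2 hc.2
        have h4 := mem_ssytLT.1 hT.1 _ hc.1
        simp only at h3 h4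
        change x (T i j) = x n
        congr 1
        omega
    · refine Finset.prod_congr rfl fun c hc => ?_
      rw [YoungDiagram.mem_cells] at hc
      change _ = x (if (c.1, c.2) ∈ rowDiagram e' then T c.1 c.2 else 0)
      rw [if_pos hc]

/-- The bialternant formula. -/
theorem alternant_eq_mul_schurPoly {n : ℕ} {e : Fin n → ℕ} (he : Antitone e) (x : ℕ → R) :
    alternant x e = alternant x (0 : Fin n → ℕ) * schurPoly n (rowDiagram e) x := by
  induction n with
  | zero =>
    have hc : (rowDiagram e).cells = ∅ := by
      rw [← Finset.card_eq_zero, card_rowDiagram he]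
      simp
    have h1 : ssytLT 0 (rowDiagram e) = {SemistandardYoungTableau.highestWeight _} := by
      ext T
      simp only [mem_ssytLT, Finset.mem_singleton, ← YoungDiagram.mem_cells, hc]
      refine ⟨fun _ => ?_, by simp⟩
      ext i j
      have : (i, j) ∉ rowDiagram e := by rw [← YoungDiagram.mem_cells, hc]; simp
      rw [T.zeros this, SemistandardYoungTableau.zeros _ this]
    simp [alternant, schurPoly, h1, hc]
  | succ n ih =>
    have h0 : alternant x (0 : Fin (n + 1) → ℕ) =
        (∏ i : Fin n, (x i - x n)) * alternant x (0 : Fin n → ℕ) := by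
      rw [alternant_succ x 0 antitone_const]
      -- Only the zero sequence interlaces the zero sequence, so `a_0` acquires exactly the factor
      -- common to all alternants.
      have : Fintype.piFinset (fun j : Fin n => Finset.Icc ((0 : Fin (n + 1) → ℕ) j.succ)
          ((0 : Fin (n + 1) → ℕ) j.castSucc)) = {0} := by
        ext k
        simp [funext_iff]
      rw [this]
      simp
    rw [alternant_succ x e he, h0, schurPoly_succ he, mul_assoc]
    congr 1
    rw [Finset.mul_sum]
    refine Finset.sum_congr rfl fun e' he' => ?_
    simp only [Fintype.mem_piFinset, Finset.mem_Icc] at he'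
    have ha : Antitone e' := by
      intro i j hij
      rcases hij.eq_or_lt with rfl | hij
      · exact le_rfl
      · exact (he' j).2.trans ((he (by exact hij)).trans (he' i).1)
    rw [ih ha]
    ring

end Bialternant

/-! ### Natural unit interval orders and recolorings with two colors -/

section NaturalUnitIntervalOrder

variable {V : Type*} [LinearOrder V] {lt : V → V → Prop}

/-- Otherwise `z` would be incomparable to both `x` and `y`, and `between` would put it below `y`.
The axiom `between` enters the proof only through this lemma and its mirror image. -/
theorem IsNaturalUnitIntervalOrder.lt_of_lt_of_le (hP : IsNaturalUnitIntervalOrder lt) {x y z : V}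
    (h : lt x y) (hyz : y ≤ z) : lt x z := by
  rcases hyz.eq_or_lt with rfl | hyz
  · exact h
  have hxy := hP.natural _ _ h
  by_contra hxz
  by_cases h1 : lt y z
  · exact hxz (hP.trans _ _ _ h h1)
  · have h2 := hP.between x z y h ⟨(hxy.trans hyz).ne, hxz, fun h' =>
      (hP.natural _ _ h').not_gt (hxy.trans hyz)⟩ ⟨hyz.ne', fun h' =>
      (hP.natural _ _ h').not_gt hyz, h1⟩
    exact h2.2.not_gt hyz

theorem IsNaturalUnitIntervalOrder.lt_of_le_of_lt (hP : IsNaturalUnitIntervalOrder lt) {x y z : V}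
    (hxy : x ≤ y) (h : lt y z) : lt x z := by
  rcases hxy.eq_or_lt with rfl | hxy
  · exact h
  have hyz := hP.natural _ _ h
  by_contra hxz
  by_cases h1 : lt x y
  · exact hxz (hP.trans _ _ _ h1 h)
  · have h2 := hP.between y x z h ⟨hxy.ne', fun h' =>
      (hP.natural _ _ h').not_gt hxy, h1⟩ ⟨(hxy.trans hyz).ne, hxz, fun h' =>
      (hP.natural _ _ h').not_gt (hxy.trans hyz)⟩
    exact h2.1.not_gt hxy

theorem IsNaturalUnitIntervalOrder.incomp_iff (hP : IsNaturalUnitIntervalOrder lt) {x y : V}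
    (h : x < y) : Incomp lt x y ↔ ¬ lt x y :=
  ⟨fun h' => h'.2.1, fun h' => ⟨h.ne, h', fun h'' => (hP.natural _ _ h'').not_gt h⟩⟩

/-- `κ` is a proper coloring of the incomparability graph of `lt`, for `lt` contained in `<`. -/
def IsProper {C : Type*} (lt : V → V → Prop) (κ : V → C) : Prop :=
  ∀ u v, u < v → ¬ lt u v → κ u ≠ κ v

theorem IsProper.lt_of_eq {C : Type*} {κ : V → C} (h : IsProper lt κ) {u v : V} (huv : u < v)
    (hκ : κ u = κ v) : lt u v := by
  by_contra h'
  exact h u v huv h' hκ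

open Classical in
/-- The number of descents of `κ`: of edges `{i, j}` of the incomparability graph with `i < j` and
`κ(j) < κ(i)`. -/
noncomputable def des {C : Type*} [LinearOrder C] [Fintype V] (lt : V → V → Prop) (κ : V → C) : ℕ :=
  (Finset.univ.filter fun p : V × V => p.1 < p.2 ∧ ¬ lt p.1 p.2 ∧ κ p.2 < κ p.1).card

/-! #### Two-colorings -/

/-- The coloring of `U` with color classes `A` and `U \ A` is proper. -/
def IsProperOn (lt : V → V → Prop) (U A : Finset V) : Prop :=
  ∀ i ∈ U, ∀ j ∈ U, i < j → ¬ lt i j → (i ∈ A ↔ j ∉ A)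

open Classical in
/-- The number of edges `{i, j}` in `U` with `i < j`, `i ∉ A` and `j ∈ A`. -/
noncomputable def desOn (lt : V → V → Prop) (U A : Finset V) : ℕ :=
  ((U ×ˢ U).filter fun p => p.1 < p.2 ∧ ¬ lt p.1 p.2 ∧ p.1 ∉ A ∧ p.2 ∈ A).card

open Classical in
/-- The term of `A` in the generating function of the proper two-colorings of `U`. -/
noncomputable def twoColorTerm {R : Type*} [CommRing R] (lt : V → V → Prop) (t : R)
    (U A : Finset V) (y z : R) : R :=
  if IsProperOn lt U A then t ^ desOn lt U A * y ^ A.card * z ^ (U \ A).card else 0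

/-! ### Adjoining a new largest vertex to a two-colored set -/

section Insert

variable {U A : Finset V} {m : V}

theorem isProperOn_insert (hm : ∀ i ∈ U, i < m) (hA : A ⊆ U) :
    IsProperOn lt (insert m U) A ↔ IsProperOn lt U A ∧ ∀ i ∈ U, ¬ lt i m → i ∈ A := by
  have hmA : m ∉ A := fun h => lt_irrefl _ (hm m (hA h))
  constructor
  · refine fun h => ⟨fun i hi j hj => h i (Finset.mem_insert_of_mem hi) j
      (Finset.mem_insert_of_mem hj), fun i hi hl => ?_⟩
    exact (h i (Finset.mem_insert_of_mem hi) m (Finset.mem_insert_self _ _) (hm i hi) hl).2 hmA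
  · rintro ⟨h1, h2⟩ i hi j hj hij hl
    rcases Finset.mem_insert.1 hi with rfl | hi'
    · rcases Finset.mem_insert.1 hj with rfl | hj'
      · exact absurd hij (lt_irrefl _)
      · exact absurd hij (hm j hj').not_gt
    · rcases Finset.mem_insert.1 hj with rfl | hj'
      · exact iff_of_true (h2 i hi' hl) hmA
      · exact h1 i hi' j hj' hij hl

theorem isProperOn_insert_insert (hm : ∀ i ∈ U, i < m) :
    IsProperOn lt (insert m U) (insert m A) ↔
      IsProperOn lt U A ∧ ∀ i ∈ U, ¬ lt i m → i ∉ A := by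
  have hmem : ∀ i ∈ U, (i ∈ insert m A ↔ i ∈ A) := fun i hi => by
    simp [(hm i hi).ne]
  constructor
  · refine fun h => ⟨fun i hi j hj hij hl => ?_, fun i hi hl => ?_⟩
    · rw [← hmem i hi, ← hmem j hj]
      exact h i (Finset.mem_insert_of_mem hi) j (Finset.mem_insert_of_mem hj) hij hl
    · have := h i (Finset.mem_insert_of_mem hi) m (Finset.mem_insert_self _ _) (hm i hi) hl
      rw [hmem i hi] at this
      exact fun h' => this.1 h' (Finset.mem_insert_self _ _)
  · rintro ⟨h1, h2⟩ i hi j hj hij hl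
    rcases Finset.mem_insert.1 hi with rfl | hi'
    · rcases Finset.mem_insert.1 hj with rfl | hj'
      · exact absurd hij (lt_irrefl _)
      · exact absurd hij (hm j hj').not_gt
    · rcases Finset.mem_insert.1 hj with rfl | hj'
      · rw [hmem i hi']
        exact iff_of_false (h2 i hi' hl) (fun h => h (Finset.mem_insert_self _ _))
      · rw [hmem i hi', hmem j hj']
        exact h1 i hi' j hj' hij hl

/-- The upper end of a counted edge lies in `A`, and the maximal vertex `m` can only be an upper
end. -/
theorem desOn_insert (hm : ∀ i ∈ U, i < m) (hA : A ⊆ U) :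
    desOn lt (insert m U) A = desOn lt U A := by
  have hmA : m ∉ A := fun h => lt_irrefl _ (hm m (hA h))
  unfold desOn
  congr 1
  ext ⟨i, j⟩
  simp only [Finset.mem_filter, Finset.mem_product, Finset.mem_insert]
  constructor
  · rintro ⟨⟨hi, hj⟩, hij, hl, h1, h2⟩
    have hj' : j ∈ U := hA h2
    refine ⟨⟨hi.resolve_left ?_, hj'⟩, hij, hl, h1, h2⟩
    rintro rfl
    exact hij.not_gt (hm j hj')
  · rintro ⟨⟨hi, hj⟩, h⟩
    exact ⟨⟨Or.inr hi, Or.inr hj⟩, h⟩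

open Classical in
theorem desOn_insert_insert (hm : ∀ i ∈ U, i < m) :
    desOn lt (insert m U) (insert m A) =
      desOn lt U A + (U.filter fun i => ¬ lt i m ∧ i ∉ A).card := by
  have hmU : m ∉ U := fun h => lt_irrefl _ (hm m h)
  have hmem : ∀ i ∈ U, (i ∈ insert m A ↔ i ∈ A) := fun i hi => by
    simp [(hm i hi).ne]
  have : (U.filter fun i => ¬ lt i m ∧ i ∉ A).card =
      ((U.filter fun i => ¬ lt i m ∧ i ∉ A).map ⟨fun i => (i, m), fun i j h => by
        simpa using h⟩).card := (Finset.card_map _).symm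
  rw [this, desOn, desOn, ← Finset.card_union_of_disjoint]
  · congr 1
    ext ⟨i, j⟩
    simp only [Finset.mem_filter, Finset.mem_product, Finset.mem_union, Finset.mem_map]
    constructor
    · rintro ⟨⟨hi, hj⟩, hij, hl, h1, h2⟩
      rcases Finset.mem_insert.1 hi with rfl | hi'
      · exact absurd (Finset.mem_insert_self _ _) h1
      rw [hmem i hi'] at h1
      rcases Finset.mem_insert.1 hj with rfl | hj'
      · exact Or.inr ⟨i, ⟨hi', hl, h1⟩, rfl⟩
      · rw [hmem j hj'] at h2
        exact Or.inl ⟨⟨hi', hj'⟩, hij, hl, h1, h2⟩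
    · rintro (⟨⟨hi, hj⟩, hij, hl, h1, h2⟩ | ⟨k, ⟨hk, hl, h1⟩, hkm⟩)
      · rw [hmem i hi, hmem j hj]
        exact ⟨⟨Finset.mem_insert_of_mem hi, Finset.mem_insert_of_mem hj⟩, hij, hl, h1, h2⟩
      · obtain ⟨rfl, rfl⟩ := Prod.mk.inj hkm
        rw [hmem k hk]
        exact ⟨⟨Finset.mem_insert_of_mem hk, Finset.mem_insert_self _ _⟩, hm k hk, hl, h1,
          Finset.mem_insert_self _ _⟩
  · rw [Finset.disjoint_left]
    rintro ⟨i, j⟩ h1 h2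
    simp only [Finset.mem_filter, Finset.mem_product, Finset.mem_map]
      at h1 h2
    obtain ⟨k, _, hk⟩ := h2
    obtain ⟨rfl, rfl⟩ := Prod.mk.inj hk
    exact hmU h1.1.2

variable {R : Type*} [CommRing R] (t y z : R)

/-- Here `m` is isolated and starts a new path, so either color is allowed and no descent is
created. -/
theorem twoColorTerm_insert_of_lt (hm : ∀ i ∈ U, i < m) (hA : A ⊆ U) (h : ∀ i ∈ U, lt i m) :
    twoColorTerm lt t (insert m U) A y z = z * twoColorTerm lt t U A y z ∧
      twoColorTerm lt t (insert m U) (insert m A) y z = y * twoColorTerm lt t U A y z := by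
  have hmU : m ∉ U := fun h => lt_irrefl _ (hm m h)
  have hmA : m ∉ A := fun h => hmU (hA h)
  classical
  have h1 : (U.filter fun i => ¬ lt i m ∧ i ∉ A) = ∅ := by
    rw [Finset.filter_eq_empty_iff]
    exact fun i hi h' => h'.1 (h i hi)
  unfold twoColorTerm
  rw [isProperOn_insert hm hA, isProperOn_insert_insert hm, desOn_insert hm hA,
    desOn_insert_insert hm, h1, Finset.insert_sdiff_of_notMem _ hmA,
    Finset.card_insert_of_notMem hmA, Finset.insert_sdiff_insert,
    Finset.sdiff_insert_of_notMem hmU,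
    Finset.card_insert_of_notMem (fun h => hmU (Finset.sdiff_subset h))]
  by_cases hp : IsProperOn lt U A
  · rw [if_pos ⟨hp, fun i hi hl => absurd (h i hi) hl⟩, if_pos hp,
      if_pos ⟨hp, fun i hi hl => absurd (h i hi) hl⟩, Finset.card_empty]
    constructor <;> ring
  · rw [if_neg fun h => hp h.1, if_neg hp, if_neg fun h => hp h.1]
    simp

/-- Here `m` prolongs the path ending at `m'`, so its color is forced. The new edge is a descent
exactly when `m` receives the color of `A`. -/
theorem twoColorTerm_insert_of_link (hm : ∀ i ∈ U, i < m) (hA : A ⊆ U) {m' : V} (hm' : m' ∈ U)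
    (h : ∀ i ∈ U, ¬ lt i m ↔ i = m') :
    twoColorTerm lt t (insert m U) A y z =
        (if m' ∈ A then z * twoColorTerm lt t U A y z else 0) ∧
      twoColorTerm lt t (insert m U) (insert m A) y z =
        if m' ∈ A then 0 else y * t * twoColorTerm lt t U A y z := by
  have hmU : m ∉ U := fun h => lt_irrefl _ (hm m h)
  have hmA : m ∉ A := fun h => hmU (hA h)
  classical
  have h1 : (U.filter fun i => ¬ lt i m ∧ i ∉ A) = if m' ∈ A then ∅ else {m'} := by
    ext i
    by_cases hi : i ∈ U
    · rw [Finset.mem_filter, h i hi]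
      split_ifs with h2
      · simp only [hi, Finset.notMem_empty, iff_false, true_and, not_and, not_not]
        rintro rfl
        exact h2
      · simp only [hi, Finset.mem_singleton, true_and, and_iff_left_iff_imp]
        rintro rfl
        exact h2
    · rw [Finset.mem_filter]
      refine iff_of_false (fun h => hi h.1) ?_
      split_ifs with h2
      · simp
      · rw [Finset.mem_singleton]
        rintro rfl
        exact hi hm'
  unfold twoColorTerm
  rw [isProperOn_insert hm hA, isProperOn_insert_insert hm, desOn_insert hm hA,
    desOn_insert_insert hm, h1, Finset.insert_sdiff_of_notMem _ hmA,
    Finset.card_insert_of_notMem hmA, Finset.insert_sdiff_insert,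
    Finset.sdiff_insert_of_notMem hmU,
    Finset.card_insert_of_notMem (fun h => hmU (Finset.sdiff_subset h))]
  by_cases hp : IsProperOn lt U A
  · by_cases h2 : m' ∈ A
    · rw [if_pos hp, if_pos h2, if_pos h2, if_pos h2, if_pos, if_neg]
      · exact ⟨by ring, rfl⟩
      · exact fun h' => h'.2 m' hm' ((h m' hm').2 rfl) h2
      · exact ⟨hp, fun i hi hl => by rwa [(h i hi).1 hl]⟩
    · rw [if_pos hp, if_neg h2, if_neg h2, if_neg h2, if_neg, if_pos, Finset.card_singleton]
      · exact ⟨rfl, by ring⟩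
      · exact ⟨hp, fun i hi hl => by rwa [(h i hi).1 hl]⟩
      · exact fun h' => h2 (h'.2 m' hm' ((h m' hm').2 rfl))
  · simp [hp]

end Insert

variable {R : Type*} [CommRing R] (t y z : R)

/-- The generating functions of the two-colorings of a disjoint union of paths, refined by the
color of the last vertex. The two cases are those of a last path with an odd and with an even
number of vertices. -/
theorem exists_twoColor_factor (U : Finset V) :
    ∀ m, (∀ i ∈ U, i < m) →
      (∀ i ∈ insert m U, ∀ j ∈ insert m U, ∀ k ∈ insert m U, i < j → j < k → lt i k) →
      ∃ Q : R,
        (∑ A ∈ U.powerset, twoColorTerm lt t (insert m U) (insert m A) y z = y * Q ∧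
          ∑ A ∈ U.powerset, twoColorTerm lt t (insert m U) A y z = z * Q ∧
          ∑ A ∈ U.powerset, twoColorTerm lt t (insert m U) (insert m A) z y = z * Q ∧
          ∑ A ∈ U.powerset, twoColorTerm lt t (insert m U) A z y = y * Q) ∨
        (∑ A ∈ U.powerset, twoColorTerm lt t (insert m U) (insert m A) y z = t * Q ∧
          ∑ A ∈ U.powerset, twoColorTerm lt t (insert m U) A y z = Q ∧
          ∑ A ∈ U.powerset, twoColorTerm lt t (insert m U) (insert m A) z y = t * Q ∧
          ∑ A ∈ U.powerset, twoColorTerm lt t (insert m U) A z y = Q) := by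
  induction U using Finset.induction_on_max with
  | empty =>
    intro m hm _
    have h0 : ∀ y z : R, twoColorTerm lt t (∅ : Finset V) ∅ y z = 1 := fun y z => by
      simp [twoColorTerm, IsProperOn, desOn]
    have h := fun y z : R => twoColorTerm_insert_of_lt (lt := lt) t y z hm
      (Finset.Subset.refl ∅) (by simp)
    refine ⟨1, Or.inl ?_⟩
    simp only [Finset.powerset_empty, Finset.sum_singleton, (h _ _).1, (h _ _).2, h0, and_self]
  | insert m' U hm' ih =>
    intro m hm htri
    have hmU : m' ∉ U := fun h => lt_irrefl _ (hm' _ h)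
    obtain ⟨Q, hQ⟩ := ih m' hm' fun i hi j hj k hk => htri i (Finset.mem_insert_of_mem hi) j
      (Finset.mem_insert_of_mem hj) k (Finset.mem_insert_of_mem hk)
    by_cases hl : lt m' m
    -- By `htri` the new maximum `m` can be adjacent only to the previous maximum `m'`: either it is
    -- isolated or it extends the last path.
    · have hall : ∀ i ∈ insert m' U, lt i m := by
        intro i hi
        rcases Finset.mem_insert.1 hi with rfl | hi
        · exact hl
        · exact htri i (by simp [hi]) m' (by simp) m (by simp) (hm' i hi) (hm m' (by simp))
      have h := fun (y z : R) A (hA : A ∈ (insert m' U).powerset) =>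
        twoColorTerm_insert_of_lt (lt := lt) t y z hm (Finset.mem_powerset.1 hA) hall
      refine ⟨∑ A ∈ (insert m' U).powerset, twoColorTerm lt t (insert m' U) A y z, Or.inl ?_⟩
      have hs : ∑ A ∈ (insert m' U).powerset, twoColorTerm lt t (insert m' U) A z y =
          ∑ A ∈ (insert m' U).powerset, twoColorTerm lt t (insert m' U) A y z := by
        rw [Finset.sum_powerset_insert hmU, Finset.sum_powerset_insert hmU]
        rcases hQ with ⟨h1, h2, h3, h4⟩ | ⟨h1, h2, h3, h4⟩ <;> rw [h1, h2, h3, h4]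
        ring
      refine ⟨?_, ?_, ?_, ?_⟩
      · rw [Finset.sum_congr rfl fun A hA => (h y z A hA).2, Finset.mul_sum]
      · rw [Finset.sum_congr rfl fun A hA => (h y z A hA).1, Finset.mul_sum]
      · rw [Finset.sum_congr rfl fun A hA => (h z y A hA).2, ← Finset.mul_sum, hs]
      · rw [Finset.sum_congr rfl fun A hA => (h z y A hA).1, ← Finset.mul_sum, hs]
    · have hlink : ∀ i ∈ insert m' U, ¬ lt i m ↔ i = m' := by
        intro i hi
        rcases Finset.mem_insert.1 hi with rfl | hi
        · simpa using hl
        · refine iff_of_false (fun h => h ?_) (hm' i hi).ne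
          exact htri i (by simp [hi]) m' (by simp) m (by simp) (hm' i hi) (hm m' (by simp))
      have h := fun (y z : R) A (hA : A ∈ (insert m' U).powerset) =>
        twoColorTerm_insert_of_link (lt := lt) t y z hm (Finset.mem_powerset.1 hA)
          (Finset.mem_insert_self m' U) hlink
      have hA1 : ∀ (y z : R), ∑ A ∈ (insert m' U).powerset,
          twoColorTerm lt t (insert m (insert m' U)) A y z =
          z * ∑ A ∈ U.powerset, twoColorTerm lt t (insert m' U) (insert m' A) y z := by
        intro y z
        rw [Finset.sum_congr rfl fun A hA => (h y z A hA).1, Finset.sum_powerset_insert hmU,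
          Finset.sum_eq_zero, zero_add, Finset.mul_sum]
        · exact Finset.sum_congr rfl fun A _ => if_pos (Finset.mem_insert_self _ _)
        · exact fun A hA => if_neg fun h' => hmU (Finset.mem_powerset.1 hA h')
      have hA2 : ∀ (y z : R), ∑ A ∈ (insert m' U).powerset,
          twoColorTerm lt t (insert m (insert m' U)) (insert m A) y z =
          y * t * ∑ A ∈ U.powerset, twoColorTerm lt t (insert m' U) A y z := by
        intro y z
        rw [Finset.sum_congr rfl fun A hA => (h y z A hA).2, Finset.sum_powerset_insert hmU,
          Finset.sum_eq_zero (f := fun A => ite (m' ∈ insert m' A) _ _), add_zero, Finset.mul_sum]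
        · exact Finset.sum_congr rfl fun A hA =>
            if_neg fun h' => hmU (Finset.mem_powerset.1 hA h')
        · exact fun A _ => if_pos (Finset.mem_insert_self _ _)
      rw [hA1, hA1, hA2, hA2]
      rcases hQ with ⟨h1, h2, h3, h4⟩ | ⟨h1, h2, h3, h4⟩ <;> rw [h1, h2, h3, h4]
      -- Lengthening the last path alternates its parity. Passing from odd to even contributes `y *
      -- z`, and from even to odd contributes `t`.
      · refine ⟨y * z * Q, Or.inr ⟨?_, ?_, ?_, ?_⟩⟩ <;> ring
      · refine ⟨t * Q, Or.inl ⟨?_, ?_, ?_, ?_⟩⟩ <;> ring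

/-- By `exists_twoColor_factor` the total is `(y + z) * Q` or `(t + 1) * Q`, with the same `Q` after
`y` and `z` are exchanged. -/
theorem sum_twoColorTerm_comm (U : Finset V)
    (htri : ∀ i ∈ U, ∀ j ∈ U, ∀ k ∈ U, i < j → j < k → lt i k) :
    ∑ A ∈ U.powerset, twoColorTerm lt t U A y z = ∑ A ∈ U.powerset, twoColorTerm lt t U A z y := by
  induction U using Finset.induction_on_max with
  | empty => simp [twoColorTerm, IsProperOn, desOn]
  | insert m U hm _ =>
    have hmU : m ∉ U := fun h => lt_irrefl _ (hm _ h)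
    rw [Finset.sum_powerset_insert hmU, Finset.sum_powerset_insert hmU]
    obtain ⟨Q, ⟨h1, h2, h3, h4⟩ | ⟨h1, h2, h3, h4⟩⟩ :=
      exists_twoColor_factor (lt := lt) t y z U m hm htri <;> rw [h1, h2, h3, h4]
    ring

open Classical in
/-- Exchanging the sizes of the two color classes in a sum over the proper two-colorings. -/
theorem sum_isProperOn_comm (U : Finset V)
    (htri : ∀ i ∈ U, ∀ j ∈ U, ∀ k ∈ U, i < j → j < k → lt i k) (h : ℕ → ℕ → R) :
    ∑ A ∈ U.powerset.filter (IsProperOn lt U), t ^ desOn lt U A * h A.card (U \ A).card =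
      ∑ A ∈ U.powerset.filter (IsProperOn lt U), t ^ desOn lt U A * h (U \ A).card A.card := by
  -- With `y` a polynomial variable and `z = 1`, the coefficients record `A.card`, which determines
  -- the other class size. Weighting them by `h` gives the claim.
  have key := sum_twoColorTerm_comm (lt := lt) (Polynomial.C t) Polynomial.X 1 U htri
  simp only [twoColorTerm, one_pow, mul_one, ← Finset.sum_filter, ← Polynomial.C_pow] at key
  have := congrArg (fun φ : Polynomial R => ∑ p ∈ Finset.range (U.card + 1),
    φ.coeff p * h p (U.card - p)) key
  simp only [Polynomial.finsetSum_coeff, Polynomial.coeff_C_mul, Polynomial.coeff_X_pow,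
    Finset.sum_mul] at this
  rw [Finset.sum_comm, Finset.sum_comm (s := Finset.range _)] at this
  have hc : ∀ A ∈ U.powerset.filter (IsProperOn lt U), A.card + (U \ A).card = U.card :=
    fun A hA => by
      have := Finset.card_sdiff_add_card_eq_card
        (Finset.mem_powerset.1 (Finset.mem_filter.1 hA).1)
      omega
  convert this using 1
  · refine Finset.sum_congr rfl fun A hA => ?_
    have := hc A hA
    rw [Finset.sum_eq_single A.card, if_pos rfl, mul_one]
    · congr 2
      omega
    · intro p _ hp
      rw [if_neg hp]
      ring
    · intro hp
      simp only [Finset.mem_range] at hp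
      omega
  · refine Finset.sum_congr rfl fun A hA => ?_
    have := hc A hA
    rw [Finset.sum_eq_single (U \ A).card, if_pos (by simp), mul_one]
    · congr 2
      omega
    · intro p _ hp
      rw [if_neg (by simpa using hp)]
      ring
    · intro hp
      simp only [Finset.mem_range] at hp
      omega

end NaturalUnitIntervalOrder

/-! ### Recoloring a separated set inside a larger coloring -/

section Recolor

variable {V C : Type*} [LinearOrder V] {lt : V → V → Prop}

/-- Recolor the vertices in `A ⊆ U` by `a` and those in `U \ A` by `b`. -/
def recolor (a b : C) (κ : V → C) (U A : Finset V) (v : V) : C :=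
  if v ∈ U then if v ∈ A then a else b else κ v

/-- `U` consists of vertices of colors `a` and `b`, and no edge joins it to the remaining vertices
of these colors. -/
structure IsSeparated (lt : V → V → Prop) (a b : C) (κ : V → C) (U : Finset V) : Prop where
  color : ∀ u ∈ U, κ u = a ∨ κ u = b
  sep : ∀ u ∈ U, ∀ v ∉ U, κ v = a ∨ κ v = b → (u < v → lt u v) ∧ (v < u → lt v u)

variable {a b : C} {κ : V → C} {U : Finset V}

theorem recolor_of_mem_of_mem {A : Finset V} {v : V} (hv : v ∈ U) (hA : v ∈ A) :
    recolor a b κ U A v = a := by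
  rw [recolor, if_pos hv, if_pos hA]

theorem recolor_of_mem_of_notMem {A : Finset V} {v : V} (hv : v ∈ U) (hA : v ∉ A) :
    recolor a b κ U A v = b := by
  rw [recolor, if_pos hv, if_neg hA]

theorem recolor_of_notMem {A : Finset V} {v : V} (hv : v ∉ U) :
    recolor a b κ U A v = κ v := if_neg hv

theorem recolor_mem {A : Finset V} {v : V} (hv : v ∈ U) :
    recolor a b κ U A v = a ∨ recolor a b κ U A v = b := by
  rw [recolor, if_pos hv]
  split_ifs <;> simp

/-- If `i` and `k` were adjacent, `j` would be adjacent to both, giving a triangle properly colored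
by only two colors. -/
theorem IsSeparated.lt_of_lt_of_lt (hP : IsNaturalUnitIntervalOrder lt)
    (hU : IsSeparated lt a b κ U) (hκ : IsProper lt κ) :
    ∀ i ∈ U, ∀ j ∈ U, ∀ k ∈ U, i < j → j < k → lt i k := by
  intro i hi j hj k hk hij hjk
  by_contra hl
  have h1 : κ i ≠ κ j := hκ i j hij fun h => hl (hP.lt_of_lt_of_le h hjk.le)
  have h2 : κ j ≠ κ k := hκ j k hjk fun h => hl (hP.lt_of_le_of_lt hij.le h)
  have h3 : κ i ≠ κ k := hκ i k (hij.trans hjk) hl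
  rcases hU.color i hi with hi | hi <;> rcases hU.color j hj with hj | hj <;>
    rcases hU.color k hk with hk | hk <;> simp_all

theorem IsSeparated.isProper_recolor_iff (hU : IsSeparated lt a b κ U) (hκ : IsProper lt κ)
    (hab : a ≠ b) {A : Finset V} :
    IsProper lt (recolor a b κ U A) ↔ IsProperOn lt U A := by
  constructor
  · intro h i hi j hj hij hl
    have := h i j hij hl
    by_cases h1 : i ∈ A <;> by_cases h2 : j ∈ A <;>
      simp_all [recolor]
  · intro h u v huv hl
    by_cases hu : u ∈ U <;> by_cases hv : v ∈ U
    · have := h u hu v hv huv hl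
      by_cases h1 : u ∈ A <;> by_cases h2 : v ∈ A <;>
        simp_all [recolor, hab.symm]
    · intro he
      rw [recolor_of_notMem hv] at he
      have h1 := recolor_mem (a := a) (b := b) (κ := κ) (A := A) hu
      rw [he] at h1
      exact hl ((hU.sep u hu v hv h1).1 huv)
    · intro he
      rw [recolor_of_notMem hu] at he
      have h1 := recolor_mem (a := a) (b := b) (κ := κ) (A := A) hv
      rw [← he] at h1
      exact hl ((hU.sep v hv u hu h1).2 huv)
    · rw [recolor_of_notMem hu, recolor_of_notMem hv]
      exact hκ u v huv hl

variable [Fintype V] [LinearOrder C]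

/-- An edge leaving `U` ends at a color other than `a` and `b`. Such a color compares in the same
way with both because `a ⋖ b`, so only edges inside `U` can change their descent status. -/
theorem IsSeparated.exists_des_recolor (hU : IsSeparated lt a b κ U) (hab : a ⋖ b) :
    ∃ d, ∀ A, A ⊆ U → des lt (recolor a b κ U A) = d + desOn lt U A := by
  classical
  refine ⟨(Finset.univ.filter fun p : V × V => ¬ (p.1 ∈ U ∧ p.2 ∈ U) ∧
    p.1 < p.2 ∧ ¬ lt p.1 p.2 ∧ κ p.2 < κ p.1).card, fun A hA => ?_⟩
  have hlt : ∀ c, c ≠ a → c ≠ b → ∀ d e, d = a ∨ d = b → e = a ∨ e = b →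
      ((c < d ↔ c < e) ∧ (d < c ↔ e < c)) := by
    intro c hca hcb
    have h1 : c < a ↔ c < b := ⟨fun h => h.trans hab.lt, fun h =>
      lt_of_le_of_ne (hab.le_of_lt h) hca⟩
    have h2 : b < c ↔ a < c := ⟨fun h => hab.lt.trans h, fun h =>
      lt_of_le_of_ne (hab.ge_of_gt h) hcb.symm⟩
    rintro d e (rfl | rfl) (rfl | rfl) <;> simp [h1, h2]
  rw [des, desOn, ← Finset.card_union_of_disjoint]
  · congr 1
    ext ⟨u, v⟩
    simp only [Finset.mem_filter, Finset.mem_univ, true_and, Finset.mem_union, Finset.mem_product]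
    by_cases huv : u < v
    swap
    · simp [huv]
    by_cases hl : lt u v
    · simp [hl]
    simp only [huv, hl, not_false_eq_true, true_and]
    by_cases hu : u ∈ U <;> by_cases hv : v ∈ U
    · by_cases h1 : u ∈ A <;> by_cases h2 : v ∈ A <;>
        simp [recolor, hu, hv, h1, h2, hab.lt, hab.lt.not_gt]
    · have hn : ¬ (κ v = a ∨ κ v = b) := fun h => hl ((hU.sep u hu v hv h).1 huv)
      rw [not_or] at hn
      rw [recolor_of_notMem hv, (hlt _ hn.1 hn.2 _ _ (recolor_mem hu) (hU.color u hu)).1]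
      simp [hv]
    · have hn : ¬ (κ u = a ∨ κ u = b) := fun h => hl ((hU.sep v hv u hu h).2 huv)
      rw [not_or] at hn
      rw [recolor_of_notMem hu, (hlt _ hn.1 hn.2 _ _ (recolor_mem hv) (hU.color v hv)).2]
      simp [hu]
    · rw [recolor_of_notMem hu, recolor_of_notMem hv]
      simp [hu]
  · rw [Finset.disjoint_left]
    rintro ⟨u, v⟩ h1 h2
    simp only [Finset.mem_filter, Finset.mem_univ, true_and, Finset.mem_product] at h1 h2
    exact h1.1 h2.1

variable {R : Type*} [CommRing R]

open Classical in
/-- If a set `S` of proper colorings is closed under the two-color recolorings of a separated set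
`U κ` attached to `κ ∈ S`, then the numbers of vertices of the two colors can be exchanged in a
sum over `S` weighted by descents. -/
theorem sum_des_comm (hP : IsNaturalUnitIntervalOrder lt) (hab : a ⋖ b) (t : R)
    (S : Finset (V → C)) (U : (V → C) → Finset V) (H H' : (V → C) → R)
    (hproper : ∀ κ ∈ S, IsProper lt κ)
    (hU : ∀ κ ∈ S, IsSeparated lt a b κ (U κ))
    (hclosed : ∀ κ ∈ S, ∀ A ⊆ U κ, IsProper lt (recolor a b κ (U κ) A) →
      recolor a b κ (U κ) A ∈ S ∧ U (recolor a b κ (U κ) A) = U κ)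
    (hH : ∀ κ ∈ S, ∃ h : ℕ → ℕ → R, ∀ A ⊆ U κ,
      H (recolor a b κ (U κ) A) = h A.card (U κ \ A).card ∧
        H' (recolor a b κ (U κ) A) = h (U κ \ A).card A.card) :
    ∑ κ ∈ S, t ^ des lt κ * H κ = ∑ κ ∈ S, t ^ des lt κ * H' κ := by
  -- The key forgets the coloring on `U κ`, so its fibers on `S` are the classes of proper
  -- recolorings of a fixed separated set.
  let key : (V → C) → Finset V × (V → C) := fun κ => (U κ, recolor a b κ (U κ) ∅)
  have hmaps : ∀ κ ∈ S, key κ ∈ S.image key := fun κ hκ => Finset.mem_image_of_mem _ hκ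
  rw [← Finset.sum_fiberwise_of_maps_to hmaps, ← Finset.sum_fiberwise_of_maps_to hmaps]
  refine Finset.sum_congr rfl fun k hk => ?_
  obtain ⟨κ, hκ, rfl⟩ := Finset.mem_image.1 hk
  have hs := hU κ hκ
  have hp := hproper κ hκ
  obtain ⟨d, hd⟩ := hs.exists_des_recolor hab
  obtain ⟨h, hh⟩ := hH κ hκ
  have hfib : ∀ F : (V → C) → R, ∑ κ' ∈ S.filter (fun κ' => key κ' = key κ), F κ' =
      ∑ A ∈ (U κ).powerset.filter (IsProperOn lt (U κ)), F (recolor a b κ (U κ) A) := by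
    intro F
    symm
    refine Finset.sum_bij' (fun A _ => recolor a b κ (U κ) A)
      (fun κ' _ => (U κ).filter fun v => κ' v = a) ?_ ?_ ?_ ?_ fun _ _ => rfl
    · intro A hA
      rw [Finset.mem_filter, Finset.mem_powerset] at hA
      have h1 := hclosed κ hκ A hA.1 ((hs.isProper_recolor_iff hp hab.ne).2 hA.2)
      rw [Finset.mem_filter]
      refine ⟨h1.1, ?_⟩
      simp only [key, h1.2, Prod.mk.injEq, true_and]
      ext v
      by_cases hv : v ∈ U κ <;> simp [recolor, hv]
    all_goals try
      intro κ' hκ'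
      rw [Finset.mem_filter] at hκ'
      obtain ⟨hκ', hkey⟩ := hκ'
      simp only [key, Prod.mk.injEq] at hkey
      -- Colorings in one fiber agree off `U κ` and use only `a` and `b` on it, so the vertices of
      -- `U κ` colored `a` determine `κ'`.
      have hoff : ∀ v ∉ U κ, κ' v = κ v := fun v hv => by
        have := congrFun hkey.2 v
        rwa [hkey.1, recolor_of_notMem hv, recolor_of_notMem hv] at this
      have hrec : recolor a b κ (U κ) ((U κ).filter fun v => κ' v = a) = κ' := by
        ext v
        by_cases hv : v ∈ U κ
        · have h1 := (hU κ' hκ').color v (by rwa [hkey.1])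
          by_cases h2 : κ' v = a
          · simp [recolor, hv, h2]
          · simp [recolor, hv, h1.resolve_left h2, hab.ne']
        · rw [recolor_of_notMem hv, hoff v hv]
    · rw [Finset.mem_filter, Finset.mem_powerset]
      refine ⟨Finset.filter_subset _ _, ?_⟩
      rw [← hs.isProper_recolor_iff hp hab.ne, hrec]
      exact hproper κ' hκ'
    · intro A hA
      rw [Finset.mem_filter, Finset.mem_powerset] at hA
      ext v
      rw [Finset.mem_filter]
      constructor
      · rintro ⟨h1, h2⟩
        by_contra h3
        rw [recolor_of_mem_of_notMem h1 h3] at h2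
        exact hab.ne h2.symm
      · exact fun h1 => ⟨hA.1 h1, recolor_of_mem_of_mem (hA.1 h1) h1⟩
    · exact hrec
  rw [hfib, hfib]
  have hl : ∀ A ∈ (U κ).powerset.filter (IsProperOn lt (U κ)),
      A ⊆ U κ := fun A hA => Finset.mem_powerset.1 (Finset.mem_filter.1 hA).1
  have hsum : ∀ (F : (V → C) → R) (f : Finset V → R),
      (∀ A ⊆ U κ, F (recolor a b κ (U κ) A) = f A) →
      ∑ A ∈ (U κ).powerset.filter (IsProperOn lt (U κ)),
        t ^ des lt (recolor a b κ (U κ) A) * F (recolor a b κ (U κ) A) =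
      t ^ d * ∑ A ∈ (U κ).powerset.filter (IsProperOn lt (U κ)),
        t ^ desOn lt (U κ) A * f A := by
    intro F f hF
    rw [Finset.mul_sum]
    refine Finset.sum_congr rfl fun A hA => ?_
    rw [hd A (hl A hA), hF A (hl A hA), pow_add, mul_assoc]
  rw [hsum H _ fun A hA => (hh A hA).1, hsum H' _ fun A hA => (hh A hA).2,
    sum_isProperOn_comm t (U κ) (hs.lt_of_lt_of_lt hP hp) h]

end Recolor

/-! ### Symmetry of the chromatic quasisymmetric function in finitely many variables -/

section Symmetry

variable {V : Type*} [LinearOrder V] [Fintype V] {lt : V → V → Prop}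
variable {R : Type*} [CommRing R] {n : ℕ}

theorem covBy_of_val_add_one {a b : Fin n} (h : (a : ℕ) + 1 = b) : a ⋖ b :=
  ⟨Fin.lt_def.2 (by omega), fun c h1 h2 => by rw [Fin.lt_def] at h1 h2; omega⟩

open Classical in
/-- The proper colorings of the incomparability graph of `lt` with `n` colors. -/
noncomputable def properColorings (lt : V → V → Prop) (n : ℕ) : Finset (V → Fin n) :=
  Finset.univ.filter (IsProper lt)

theorem mem_properColorings {κ : V → Fin n} : κ ∈ properColorings lt n ↔ IsProper lt κ := by
  simp [properColorings]

/-- The generating function of the proper colorings with `n` colors, counted by descents. -/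
noncomputable def desSum (lt : V → V → Prop) (t : R) (y : Fin n → R) : R :=
  ∑ κ ∈ properColorings lt n, t ^ des lt κ * ∏ v, y (κ v)

theorem prod_recolor {C M : Type*} [CommMonoid M] (a b : C) (κ : V → C) {U A : Finset V}
    (hA : A ⊆ U) (f : C → M) :
    ∏ v, f (recolor a b κ U A v) =
      (∏ v ∈ Finset.univ \ U, f (κ v)) * (f a ^ A.card * f b ^ (U \ A).card) := by
  rw [← Finset.prod_sdiff (Finset.subset_univ U), ← Finset.prod_sdiff hA, mul_comm (f a ^ _)]
  congr 1
  · refine Finset.prod_congr rfl fun v hv => ?_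
    rw [recolor_of_notMem (Finset.mem_sdiff.1 hv).2]
  · congr 1
    · rw [Finset.prod_congr rfl fun v hv => by
        rw [recolor_of_mem_of_notMem (Finset.mem_sdiff.1 hv).1 (Finset.mem_sdiff.1 hv).2],
        Finset.prod_const]
    · rw [Finset.prod_congr rfl fun v hv => by
        rw [recolor_of_mem_of_mem (hA hv) hv], Finset.prod_const]

/-- The set of all vertices colored `a` or `b` is trivially separated and unchanged by recoloring,
so `sum_des_comm` applies to it. -/
theorem desSum_comp_swap (hP : IsNaturalUnitIntervalOrder lt) (t : R) {a b : Fin n}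
    (hab : a ⋖ b) (y : Fin n → R) : desSum lt t (y ∘ Equiv.swap a b) = desSum lt t y := by
  symm
  refine sum_des_comm hP hab t _ (fun κ => Finset.univ.filter fun v => κ v = a ∨ κ v = b)
    (fun κ => ∏ v, y (κ v)) (fun κ => ∏ v, (y ∘ Equiv.swap a b) (κ v)) ?_ ?_ ?_ ?_
  · exact fun κ hκ => mem_properColorings.1 hκ
  · refine fun κ hκ => ⟨fun u hu => (Finset.mem_filter.1 hu).2, fun u _ v hv h => ?_⟩
    exact absurd (by simpa using h) hv
  · refine fun κ hκ A hA hp => ⟨mem_properColorings.2 hp, ?_⟩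
    ext v
    by_cases hv : v ∈ Finset.univ.filter fun v => κ v = a ∨ κ v = b
    · simpa [hv] using recolor_mem hv
    · rw [Finset.mem_filter, Finset.mem_filter, recolor_of_notMem hv]
  · intro κ hκ
    refine ⟨fun p q => (∏ v ∈ Finset.univ \ Finset.univ.filter fun v => κ v = a ∨ κ v = b,
      y (κ v)) * (y a ^ p * y b ^ q), fun A hA => ⟨prod_recolor a b κ hA y, ?_⟩⟩
    refine (prod_recolor a b κ hA (y ∘ Equiv.swap a b)).trans ?_
    simp only [Function.comp_apply, Equiv.swap_apply_left, Equiv.swap_apply_right]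
    rw [mul_comm (y b ^ _)]
    congr 1
    refine Finset.prod_congr rfl fun v hv => ?_
    simp only [Finset.mem_sdiff, Finset.mem_univ, Finset.mem_filter, true_and, not_or] at hv
    rw [Equiv.swap_apply_of_ne_of_ne hv.1 hv.2]

theorem desSum_comp_perm (hP : IsNaturalUnitIntervalOrder lt) (t : R) (σ : Equiv.Perm (Fin n))
    (y : Fin n → R) : desSum lt t (y ∘ σ) = desSum lt t y := by
  cases n with
  | zero => rw [Subsingleton.elim (y ∘ σ) y]
  | succ n =>
    have hσ : σ ∈ Submonoid.closure
        (Set.range fun i : Fin n => Equiv.swap i.castSucc i.succ) := by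
      rw [Equiv.Perm.mclosure_swap_castSucc_succ]
      trivial
    induction hσ using Submonoid.closure_induction generalizing y with
    | mem σ h =>
      obtain ⟨i, rfl⟩ := h
      exact desSum_comp_swap hP t (covBy_of_val_add_one (by simp)) y
    | one => rfl
    | mul σ τ _ _ h1 h2 => rw [Equiv.Perm.coe_mul, ← Function.comp_assoc, h2, h1]

/-- The sizes of the color classes. -/
def colorType {V : Type*} [Fintype V] (κ : V → Fin n) (c : Fin n) : ℕ := (Finset.univ.filter fun v => κ v = c).card

theorem prod_eq_prod_pow_colorType {V : Type*} [Fintype V] (κ : V → Fin n) (y : Fin n → R) :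
    ∏ v, y (κ v) = ∏ c, y c ^ colorType κ c := by
  rw [← Finset.prod_fiberwise Finset.univ κ]
  refine Finset.prod_congr rfl fun c _ => ?_
  rw [Finset.prod_congr rfl fun v hv => by rw [(Finset.mem_filter.1 hv).2], Finset.prod_const]
  rfl

/-- In the expansion of `a_0`, the term of `σ` is multiplied by the generating function with its
variables permuted by `σ`, which symmetry permits. For each `κ` the terms then reassemble into one
determinant. -/
theorem alternant_zero_mul_desSum (hP : IsNaturalUnitIntervalOrder lt) (t : R) (x : ℕ → R) :
    alternant x (0 : Fin n → ℕ) * desSum lt t (fun i : Fin n => x i) =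
      ∑ κ ∈ properColorings lt n, t ^ des lt κ * alternant x (colorType κ) := by
  have h : ∀ σ : Equiv.Perm (Fin n), desSum lt t (fun i : Fin n => x i) =
      ∑ κ ∈ properColorings lt n, t ^ des lt κ * ∏ c, x (σ c) ^ colorType κ c := by
    intro σ
    rw [← desSum_comp_perm hP t σ]
    refine Finset.sum_congr rfl fun κ _ => ?_
    rw [prod_eq_prod_pow_colorType]
    rfl
  simp only [alternant, Matrix.det_apply]
  rw [Finset.sum_mul]
  simp only [Finset.mul_sum]
  rw [Finset.sum_comm]
  refine Finset.sum_congr rfl fun σ _ => ?_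
  rw [h σ, Finset.mul_sum]
  refine Finset.sum_congr rfl fun κ _ => ?_
  rw [smul_mul_assoc, mul_smul_comm]
  congr 1
  rw [mul_left_comm, ← Finset.prod_mul_distrib]
  congr 1
  refine Finset.prod_congr rfl fun c _ => ?_
  simp only [Matrix.of_apply, Pi.zero_apply, zero_add]
  rw [← pow_add, add_comm]

end Symmetry

/-! ### Cancellation of the colorings that do not come from tableaux -/

section Flaws

variable {V : Type*} [LinearOrder V] [Fintype V] {lt : V → V → Prop} {n : ℕ}

/-- The number of vertices to the left of `v` in its row (color class). -/
def rowPos (κ : V → Fin n) (v : V) : ℕ :=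
  (Finset.univ.filter fun u => u < v ∧ κ u = κ v).card

open Classical in
/-- The number of vertices in the row above `v` that do not exceed `v` in the order `lt`. -/
noncomputable def aboveCount (lt : V → V → Prop) (κ : V → Fin n) (v : V) : ℕ :=
  (Finset.univ.filter fun u => (κ u : ℕ) + 1 = κ v ∧ ¬ lt v u).card

/-- The cell above `v` is empty or its entry exceeds `v`. -/
def IsFlaw (lt : V → V → Prop) (κ : V → Fin n) (v : V) : Prop :=
  (κ v : ℕ) ≠ 0 ∧ aboveCount lt κ v ≤ rowPos κ v

/-- `v` is the lowest flaw in the leftmost column with a flaw. -/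
def IsFirstFlaw (lt : V → V → Prop) (κ : V → Fin n) (v : V) : Prop :=
  IsFlaw lt κ v ∧ ∀ w, IsFlaw lt κ w → rowPos κ v < rowPos κ w ∨
    rowPos κ v = rowPos κ w ∧ κ w ≤ κ v

theorem rowPos_lt_rowPos {κ : V → Fin n} {u v : V} (h : κ u = κ v) (huv : u < v) :
    rowPos κ u < rowPos κ v := by
  refine Finset.card_lt_card ⟨fun w hw => ?_, fun h' => ?_⟩
  · simp only [Finset.mem_filter, Finset.mem_univ, true_and] at hw ⊢
    exact ⟨hw.1.trans huv, hw.2.trans h⟩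
  · have := h' (Finset.mem_filter.2 ⟨Finset.mem_univ u, huv, h⟩)
    simp at this

theorem eq_of_rowPos_eq {κ : V → Fin n} {u v : V} (h : κ u = κ v)
    (hp : rowPos κ u = rowPos κ v) : u = v := by
  rcases lt_trichotomy u v with h1 | h1 | h1
  · exact absurd hp (rowPos_lt_rowPos h h1).ne
  · exact h1
  · exact absurd hp (rowPos_lt_rowPos h.symm h1).ne'

theorem IsFirstFlaw.unique {κ : V → Fin n} {v w : V} (hv : IsFirstFlaw lt κ v)
    (hw : IsFirstFlaw lt κ w) : v = w := by
  have h1 := hv.2 w hw.1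
  have h2 := hw.2 v hv.1
  exact eq_of_rowPos_eq (κ := κ) (by omega) (by omega)

theorem exists_isFirstFlaw {κ : V → Fin n} (h : ∃ v, IsFlaw lt κ v) :
    ∃ v, IsFirstFlaw lt κ v := by
  classical
  obtain ⟨v₀, h₀⟩ := h
  obtain ⟨v, hv, hmin⟩ := Finset.exists_min_image (Finset.univ.filter (IsFlaw lt κ))
    -- The dual order breaks ties in favor of the largest color, that is, the lowest row.
    (fun v => toLex (rowPos κ v, OrderDual.toDual (κ v))) ⟨v₀, by simpa using h₀⟩
  refine ⟨v, (Finset.mem_filter.1 hv).2, fun w hw => ?_⟩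
  have := hmin w (by simpa using hw)
  rw [Prod.Lex.le_iff] at this
  exact this

variable {κ : V → Fin n} {a b : Fin n} {v : V}

/-- The left neighbor `w` of `v` is not a flaw, so more than `rowPos κ w` entries of row `a` do not
exceed `w`. None of these exceeds `v`, and the flaw at `v` allows at most `rowPos κ w + 1` such
entries. Hence the two sets coincide, and since `lt w v`, all their members lie to the left of `v`.
If `v` begins its row, both counts are zero. -/
theorem IsFirstFlaw.card_not_lt (hP : IsNaturalUnitIntervalOrder lt) [DecidableRel lt]
    (hκ : IsProper lt κ) (hf : IsFirstFlaw lt κ v) (hab : (a : ℕ) + 1 = b) (hv : κ v = b) :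
    (Finset.univ.filter fun u => κ u = a ∧ ¬ lt v u).card = rowPos κ v ∧
      ∀ u, κ u = a → ¬ lt v u → u < v := by
  have habove : ∀ w, κ w = b →
      aboveCount lt κ w = (Finset.univ.filter fun u => κ u = a ∧ ¬ lt w u).card := by
    intro w hw
    unfold aboveCount
    congr 1
    ext u
    simp only [Finset.mem_filter, Finset.mem_univ, true_and, hw, Fin.ext_iff]
    refine and_congr_left fun _ => ?_
    omega
  have hle := hf.1.2
  rw [habove v hv] at hle
  rcases Finset.eq_empty_or_nonempty (Finset.univ.filter fun u => u < v ∧ κ u = κ v) with h0 | h0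
  · have h1 : rowPos κ v = 0 := by rw [rowPos, h0, Finset.card_empty]
    rw [h1, Nat.le_zero, Finset.card_eq_zero] at hle
    refine ⟨by rw [hle, h1, Finset.card_empty], fun u hu hl => ?_⟩
    have : u ∈ Finset.univ.filter fun u => κ u = a ∧ ¬ lt v u := by simp [hu, hl]
    rw [hle] at this
    simp at this
  · obtain ⟨w, hw, hmax⟩ := Finset.exists_max_image _ id h0
    simp only [Finset.mem_filter, Finset.mem_univ, true_and, id_eq] at hw hmax
    have hpos : rowPos κ v = rowPos κ w + 1 := by
      have : (Finset.univ.filter fun u => u < v ∧ κ u = κ v) =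
          insert w (Finset.univ.filter fun u => u < w ∧ κ u = κ w) := by
        ext u
        simp only [Finset.mem_filter, Finset.mem_univ, true_and, Finset.mem_insert, hw.2]
        constructor
        · intro h
          rcases (hmax u h).eq_or_lt with h' | h'
          · exact Or.inl h'
          · exact Or.inr ⟨h', h.2⟩
        · rintro (rfl | h)
          · exact hw
          · exact ⟨h.1.trans hw.1, h.2⟩
      rw [rowPos, this, Finset.card_insert_of_notMem (by simp)]
      rfl
    have hnf : ¬ IsFlaw lt κ w := fun h => by
      have := hf.2 w h
      omega
    have hw2 : rowPos κ w < aboveCount lt κ w := by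
      by_contra h
      exact hnf ⟨by rw [hw.2]; exact hf.1.1, not_lt.1 h⟩
    rw [habove w (hw.2.trans hv)] at hw2
    have hss : (Finset.univ.filter fun u => κ u = a ∧ ¬ lt w u) ⊆
        Finset.univ.filter fun u => κ u = a ∧ ¬ lt v u := by
      intro u hu
      simp only [Finset.mem_filter, Finset.mem_univ, true_and] at hu ⊢
      exact ⟨hu.1, fun h => hu.2 (hP.lt_of_le_of_lt hw.1.le h)⟩
    have hcard := Finset.card_le_card hss
    refine ⟨by omega, fun u hu hl => ?_⟩
    have heq := Finset.eq_of_subset_of_card_le hss (by omega)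
    have hmem : u ∈ Finset.univ.filter fun u => κ u = a ∧ ¬ lt v u := by simp [hu, hl]
    rw [← heq, Finset.mem_filter] at hmem
    by_contra hvu
    exact hmem.2.2 (hP.lt_of_lt_of_le (hκ.lt_of_eq hw.1 hw.2) (not_lt.1 hvu))

open Classical in
/-- The vertices of colors `a` and `b` exceeding `v` in the order `lt`. -/
noncomputable def upperRegion {V : Type*} [Fintype V] (lt : V → V → Prop) (a b : Fin n) (v : V) (κ : V → Fin n) :
    Finset V :=
  Finset.univ.filter fun w => (κ w = a ∨ κ w = b) ∧ lt v w

theorem mem_upperRegion {V : Type*} [Fintype V] {lt : V → V → Prop} {κ : V → Fin n} {v w : V} :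
    w ∈ upperRegion lt a b v κ ↔ (κ w = a ∨ κ w = b) ∧ lt v w := by
  simp [upperRegion]

theorem IsFirstFlaw.le_of_notMem (hP : IsNaturalUnitIntervalOrder lt) (hκ : IsProper lt κ)
    (hf : IsFirstFlaw lt κ v) (hab : (a : ℕ) + 1 = b) (hv : κ v = b) {w : V}
    (hw : w ∉ upperRegion lt a b v κ) (hc : κ w = a ∨ κ w = b) : w ≤ v := by
  classical
  have hl : ¬ lt v w := fun h => hw (mem_upperRegion.2 ⟨hc, h⟩)
  rcases hc with hc | hc
  · exact ((hf.card_not_lt hP hκ hab hv).2 w hc hl).le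
  · by_contra h
    exact hl (hκ.lt_of_eq (not_le.1 h) (hv.trans hc.symm))

/-- The vertices of these two colors outside the region are at most `v`, while those inside exceed
`v` in `P`; hence no edge joins the two parts. -/
theorem IsFirstFlaw.isSeparated (hP : IsNaturalUnitIntervalOrder lt) (hκ : IsProper lt κ)
    (hf : IsFirstFlaw lt κ v) (hab : (a : ℕ) + 1 = b) (hv : κ v = b) :
    IsSeparated lt a b κ (upperRegion lt a b v κ) := by
  refine ⟨fun u hu => (mem_upperRegion.1 hu).1, fun u hu w hw hc => ?_⟩
  have hwv := hf.le_of_notMem hP hκ hab hv hw hc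
  have hvu := (mem_upperRegion.1 hu).2
  exact ⟨fun h => absurd (h.trans_le hwv) (hP.natural _ _ hvu).not_gt,
    fun _ => hP.lt_of_le_of_lt hwv hvu⟩

/-- The surplus of one in row `b` cancels the staircase shift between columns `a` and `b` of the
alternant; see `alternant_comp_swap_add`. -/
theorem IsFirstFlaw.card_notMem (hP : IsNaturalUnitIntervalOrder lt) (hκ : IsProper lt κ)
    (hf : IsFirstFlaw lt κ v) (hab : (a : ℕ) + 1 = b) (hv : κ v = b) :
    ((Finset.univ \ upperRegion lt a b v κ).filter fun u => κ u = a).card = rowPos κ v ∧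
      ((Finset.univ \ upperRegion lt a b v κ).filter fun u => κ u = b).card =
        rowPos κ v + 1 := by
  classical
  have hne : a ≠ b := fun h => by rw [h] at hab; omega
  constructor
  · rw [← (hf.card_not_lt hP hκ hab hv).1]
    congr 1
    ext u
    simp only [Finset.mem_filter, Finset.mem_sdiff, Finset.mem_univ, true_and, mem_upperRegion]
    constructor
    · exact fun h => ⟨h.2, fun hl => h.1 ⟨Or.inl h.2, hl⟩⟩
    · exact fun h => ⟨fun h' => h.2 h'.2, h.1⟩
  · have hins : (Finset.univ \ upperRegion lt a b v κ).filter (fun u => κ u = b) =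
        insert v (Finset.univ.filter fun u => u < v ∧ κ u = κ v) := by
      ext u
      simp only [Finset.mem_filter, Finset.mem_sdiff, Finset.mem_univ, true_and,
        Finset.mem_insert, hv]
      constructor
      · intro h
        rcases (hf.le_of_notMem hP hκ hab hv h.1 (Or.inr h.2)).eq_or_lt with h' | h'
        · exact Or.inl h'
        · exact Or.inr ⟨h', h.2⟩
      · rintro (rfl | h)
        · exact ⟨fun h => hP.irrefl _ (mem_upperRegion.1 h).2, hv⟩
        · exact ⟨fun h' => (hP.natural _ _ (mem_upperRegion.1 h').2).not_gt h.1, h.2⟩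
    rw [hins, Finset.card_insert_of_notMem (by simp)]
    rfl

/-- Recoloring the part of two adjacent rows to the right of the first flaw preserves it. -/
theorem IsFirstFlaw.recolor (hP : IsNaturalUnitIntervalOrder lt) (hκ : IsProper lt κ)
    (hf : IsFirstFlaw lt κ v) (hab : (a : ℕ) + 1 = b) (hv : κ v = b) (A : Finset V) :
    IsFirstFlaw lt (recolor a b κ (upperRegion lt a b v κ) A) v ∧
      recolor a b κ (upperRegion lt a b v κ) A v = b ∧
      upperRegion lt a b v (recolor a b κ (upperRegion lt a b v κ) A) =
        upperRegion lt a b v κ := by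
  classical
  obtain ⟨hca, hcb⟩ := hf.card_notMem hP hκ hab hv
  have hle := fun w => hf.le_of_notMem hP hκ hab hv (w := w)
  set U := upperRegion lt a b v κ with hUdef
  have hUlt : ∀ u ∈ U, lt v u := fun u hu => (mem_upperRegion.1 hu).2
  have hUc : ∀ u ∈ U, κ u = a ∨ κ u = b := fun u hu => (mem_upperRegion.1 hu).1
  set κ' := ChromaticQuasi.recolor a b κ U A with hκ'
  have hoff : ∀ w ∉ U, κ' w = κ w := fun w hw => recolor_of_notMem hw
  have hon : ∀ w ∈ U, κ' w = a ∨ κ' w = b := fun w hw => recolor_mem hw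
  have hvU : v ∉ U := fun h => hP.irrefl _ (hUlt v h)
  have hpos : ∀ w ∉ U, rowPos κ' w = rowPos κ w := by
    intro w hw
    unfold rowPos
    congr 1
    ext u
    simp only [Finset.mem_filter, Finset.mem_univ, true_and, hoff w hw]
    refine and_congr_right fun huw => ?_
    by_cases hu : u ∈ U
    · have hn : ¬ (κ w = a ∨ κ w = b) := fun h =>
        ((hP.natural _ _ (hUlt u hu)).trans huw).not_ge (hle w hw h)
      refine iff_of_false (fun h => hn ?_) (fun h => hn ?_)
      · rw [← h]
        exact hon u hu
      · rw [← h]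
        exact hUc u hu
    · rw [hoff u hu]
  -- The untouched entries of either row precede all of `U`, and there are at least `rowPos κ v` of
  -- them. So recolored vertices stay out of the columns left of `v`.
  have hposU : ∀ w ∈ U, rowPos κ v ≤ rowPos κ' w := by
    intro w hw
    have hsub : ∀ c, κ' w = c → (Finset.univ \ U).filter (fun u => κ u = c) ⊆
        Finset.univ.filter fun u => u < w ∧ κ' u = κ' w := by
      intro c hc u hu
      simp only [Finset.mem_filter, Finset.mem_sdiff, Finset.mem_univ, true_and] at hu ⊢
      refine ⟨(hle u hu.1 ?_).trans_lt (hP.natural _ _ (hUlt w hw)), ?_⟩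
      · rw [hu.2, ← hc]
        exact hon w hw
      · rw [hoff u hu.1, hu.2, hc]
    rcases hon w hw with hc | hc
    · have := Finset.card_le_card (hsub a hc)
      rw [hca] at this
      exact this
    · have := Finset.card_le_card (hsub b hc)
      rw [hcb] at this
      exact (Nat.le_succ _).trans this
  -- Only vertices in row `b` or `b + 1` can see a change in the row above. They do not if all
  -- recolored vertices exceed them in `P`.
  have habove : ∀ w ∉ U, (κ w = b ∨ (κ w : ℕ) = b + 1 → ∀ u ∈ U, lt w u) →
      aboveCount lt κ' w = aboveCount lt κ w := by
    intro w hw hlt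
    unfold aboveCount
    congr 1
    ext u
    simp only [Finset.mem_filter, Finset.mem_univ, true_and, hoff w hw]
    refine and_congr_left fun hl => ?_
    by_cases hu : u ∈ U
    · have hn : ¬ (κ w = b ∨ (κ w : ℕ) = b + 1) := fun h => hl (hlt h u hu)
      rw [not_or, Fin.ext_iff] at hn
      have h1 := hon u hu
      have h2 := hUc u hu
      simp only [Fin.ext_iff] at h1 h2
      omega
    · rw [hoff u hu]
  refine ⟨⟨⟨?_, ?_⟩, fun w hw => ?_⟩, ?_, ?_⟩
  · rw [hoff v hvU]
    exact hf.1.1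
  · rw [hpos v hvU, habove v hvU fun _ => hUlt]
    exact hf.1.2
  · rw [hpos v hvU, hoff v hvU]
    by_cases hwU : w ∈ U
    · have h1 := hposU w hwU
      have h2 := hon w hwU
      rw [hv]
      simp only [Fin.ext_iff] at h2
      rw [Fin.le_def]
      omega
    · rw [hpos w hwU, hoff w hwU]
      by_cases hwp : rowPos κ w ≤ rowPos κ v
      swap
      · exact Or.inl (not_le.1 hwp)
      refine hf.2 w ⟨by rw [← hoff w hwU]; exact hw.1, ?_⟩
      have hw2 := hw.2
      rw [hpos w hwU] at hw2
      rw [← habove w hwU]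
      · exact hw2
      rintro (hc | hc) u hu
      · exact hP.lt_of_le_of_lt (hle w hwU (Or.inr hc)) (hUlt u hu)
      -- Row `b` keeps `rowPos κ v + 1` vertices outside `U`, too many for a flaw `w` in a column up
      -- to that of `v` unless some `y` among them exceeds `w`. Then every element of `U` exceeds
      -- `w` as well.
      · have hex : ∃ y ∉ U, κ y = b ∧ lt w y := by
          by_contra hne
          push Not at hne
          have hsub : (Finset.univ \ U).filter (fun u => κ u = b) ⊆
              Finset.univ.filter fun u => (κ' u : ℕ) + 1 = κ' w ∧ ¬ lt w u := by
            intro y hy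
            simp only [Finset.mem_filter, Finset.mem_sdiff, Finset.mem_univ, true_and] at hy ⊢
            rw [hoff y hy.1, hoff w hwU, hy.2, hc]
            exact ⟨rfl, hne y hy.1 hy.2⟩
          have h1 := Finset.card_le_card hsub
          rw [hcb] at h1
          change _ ≤ aboveCount lt κ' w at h1
          omega
        obtain ⟨y, hyU, hyb, hly⟩ := hex
        exact hP.lt_of_lt_of_le hly
          ((hle y hyU (Or.inr hyb)).trans (hP.natural _ _ (hUlt u hu)).le)
  · rw [hoff v hvU, hv]
  · ext w
    rw [mem_upperRegion]
    by_cases hw : w ∈ U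
    · exact iff_of_true ⟨hon w hw, hUlt w hw⟩ hw
    · rw [hoff w hw, hUdef, mem_upperRegion]

variable {R : Type*} [CommRing R]

/-- Since `o b = o a + 1` and `b = a + 1`, the base exponents `o c + (n - 1 - c)` agree at `a` and
`b`. Exchanging `p` and `q` therefore interchanges two columns. -/
theorem alternant_comp_swap_add (x : ℕ → R) (hab : (a : ℕ) + 1 = b) (o : Fin n → ℕ)
    (ho : o b = o a + 1) (p q : ℕ) :
    alternant x (fun c => o c + ((if a = c then p else 0) + if b = c then q else 0)) =
      - alternant x (fun c => o c + ((if a = c then q else 0) + if b = c then p else 0)) := by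
  have hne : a ≠ b := fun h => by rw [h] at hab; omega
  have hb := b.2
  unfold alternant
  rw [← one_mul (Matrix.det (Matrix.of fun i j : Fin n => x i ^
    (o j + ((if a = j then q else 0) + if b = j then p else 0) + (n - 1 - j)))), ← neg_mul]
  have := Matrix.det_permute' (Equiv.swap a b) (Matrix.of fun i j : Fin n => x i ^
    (o j + ((if a = j then q else 0) + if b = j then p else 0) + (n - 1 - j)))
  rw [Equiv.Perm.sign_swap hne] at this
  simp only [Units.val_neg, Units.val_one, Int.cast_neg, Int.cast_one] at this
  rw [← this]
  congr 1
  ext i j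
  simp only [Matrix.of_apply, Matrix.submatrix_apply, id_eq]
  congr 1
  by_cases hja : j = a
  · subst hja
    simp only [Equiv.swap_apply_left, if_true, hne, hne.symm, if_false]
    omega
  by_cases hjb : j = b
  · subst hjb
    simp only [Equiv.swap_apply_right, if_true, hne, hne.symm, if_false]
    omega
  · rw [Equiv.swap_apply_of_ne_of_ne hja hjb]
    simp [Ne.symm hja, Ne.symm hjb]

theorem colorType_recolor (κ : V → Fin n) {U A : Finset V} (hA : A ⊆ U) (c : Fin n) :
    colorType (recolor a b κ U A) c = ((Finset.univ \ U).filter fun u => κ u = c).card +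
      ((if a = c then A.card else 0) + if b = c then (U \ A).card else 0) := by
  -- In multiplicative notation, the product formula for an indicator function counts vertices.
  have h := prod_recolor (M := Multiplicative ℕ) a b κ hA
    (fun d => Multiplicative.ofAdd (if d = c then 1 else 0))
  have h2 := congrArg Multiplicative.toAdd h
  simp only [toAdd_prod, toAdd_mul, toAdd_pow, toAdd_ofAdd, smul_eq_mul, mul_ite, mul_one,
    mul_zero] at h2
  rw [colorType, Finset.card_filter, h2, Finset.card_filter]

/-- Exchanging the class sizes within `upperRegion` preserves the sum by `sum_des_comm` but negates
every alternant. The sum equals its own negative. -/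
theorem sum_firstFlaw_eq_zero [IsDomain R] [CharZero R] (hP : IsNaturalUnitIntervalOrder lt)
    (t : R) (x : ℕ → R) (b : Fin n) (v : V) (S : Finset (V → Fin n))
    (hS : ∀ κ, κ ∈ S ↔ IsProper lt κ ∧ IsFirstFlaw lt κ v ∧ κ v = b) :
    ∑ κ ∈ S, t ^ des lt κ * alternant x (colorType κ) = 0 := by
  by_cases hb : (b : ℕ) = 0
  · refine Finset.sum_eq_zero fun κ hκ => ?_
    obtain ⟨_, hf, hv⟩ := (hS κ).1 hκ
    exact absurd (by rw [hv]; exact hb) hf.1.1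
  obtain ⟨a, hab⟩ : ∃ a : Fin n, (a : ℕ) + 1 = b :=
    ⟨⟨b - 1, by omega⟩, Nat.sub_add_cancel (Nat.one_le_iff_ne_zero.2 hb)⟩
  have key := sum_des_comm hP (covBy_of_val_add_one hab) t S (upperRegion lt a b v)
    (fun κ => alternant x (colorType κ)) (fun κ => - alternant x (colorType κ))
    (fun κ hκ => ((hS κ).1 hκ).1)
    (fun κ hκ => ((hS κ).1 hκ).2.1.isSeparated hP ((hS κ).1 hκ).1 hab ((hS κ).1 hκ).2.2)
    (fun κ hκ A _ hp => by
      have := ((hS κ).1 hκ).2.1.recolor hP ((hS κ).1 hκ).1 hab ((hS κ).1 hκ).2.2 A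
      exact ⟨(hS _).2 ⟨hp, this.1, this.2.1⟩, this.2.2⟩)
    (fun κ hκ => by
      obtain ⟨hca, hcb⟩ :=
        ((hS κ).1 hκ).2.1.card_notMem hP ((hS κ).1 hκ).1 hab ((hS κ).1 hκ).2.2
      refine ⟨fun p q => alternant x fun c =>
        ((Finset.univ \ upperRegion lt a b v κ).filter fun u => κ u = c).card +
          ((if a = c then p else 0) + if b = c then q else 0), fun A hA => ?_⟩
      have := funext (colorType_recolor (a := a) (b := b) κ hA)
      refine ⟨congrArg (alternant x) this, ?_⟩
      simp only [this]
      rw [alternant_comp_swap_add x hab _ (by rw [hca, hcb]), neg_neg])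
  simp only [mul_neg, Finset.sum_neg_distrib] at key
  exact self_eq_neg.1 key

open Classical in
/-- The colorings with a flaw cancel. -/
theorem sum_exists_flaw_eq_zero [IsDomain R] [CharZero R] (hP : IsNaturalUnitIntervalOrder lt)
    (t : R) (x : ℕ → R) :
    ∑ κ ∈ (properColorings lt n).filter (fun κ => ∃ v, IsFlaw lt κ v),
      t ^ des lt κ * alternant x (colorType κ) = 0 := by
  have h1 : ∀ κ ∈ (properColorings lt n).filter (fun κ => ∃ v, IsFlaw lt κ v),
      t ^ des lt κ * alternant x (colorType κ) = ∑ v : V, ∑ b : Fin n,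
        if IsFirstFlaw lt κ v ∧ κ v = b then t ^ des lt κ * alternant x (colorType κ) else 0 := by
    intro κ hκ
    obtain ⟨v, hv⟩ := exists_isFirstFlaw (Finset.mem_filter.1 hκ).2
    rw [Finset.sum_eq_single v, Finset.sum_eq_single (κ v), if_pos ⟨hv, rfl⟩]
    · exact fun b _ hb => if_neg fun h => hb h.2.symm
    · simp
    · exact fun w _ hw => Finset.sum_eq_zero fun b _ => if_neg fun h => hw (h.1.unique hv)
    · simp
  rw [Finset.sum_congr rfl h1, Finset.sum_comm]
  refine Finset.sum_eq_zero fun v _ => ?_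
  rw [Finset.sum_comm]
  refine Finset.sum_eq_zero fun b _ => ?_
  rw [← Finset.sum_filter]
  refine sum_firstFlaw_eq_zero hP t x b v _ fun κ => ?_
  simp only [Finset.mem_filter, mem_properColorings, and_assoc]
  exact ⟨fun h => ⟨h.1, h.2.2⟩, fun h => ⟨h.1, ⟨v, h.2.1.1⟩, h.2⟩⟩

end Flaws

/-! ### Flawless colorings and tableaux -/

section Tableaux

variable {V : Type*} [LinearOrder V] [Fintype V] {lt : V → V → Prop} {n : ℕ}

/-- The last vertex of a row is not a flaw, so the row above has at least as many vertices as its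
own row. -/
theorem colorType_antitone {κ : V → Fin n} (hg : ∀ v, ¬ IsFlaw lt κ v) :
    Antitone (colorType κ) := by
  have h : ∀ a b : Fin n, (a : ℕ) + 1 = b → colorType κ b ≤ colorType κ a := by
    intro a b hab
    rcases Finset.eq_empty_or_nonempty (Finset.univ.filter fun v => κ v = b) with h0 | h0
    · rw [colorType, h0, Finset.card_empty]
      exact Nat.zero_le _
    · obtain ⟨v, hv, hmax⟩ := Finset.exists_max_image _ id h0
      simp only [Finset.mem_filter, Finset.mem_univ, true_and, id_eq] at hv hmax
      have h1 : rowPos κ v < aboveCount lt κ v := by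
        by_contra h
        exact hg v ⟨by rw [hv]; omega, not_lt.1 h⟩
      have h2 : colorType κ b = rowPos κ v + 1 := by
        have : (Finset.univ.filter fun u => κ u = b) =
            insert v (Finset.univ.filter fun u => u < v ∧ κ u = κ v) := by
          ext u
          simp only [Finset.mem_filter, Finset.mem_univ, true_and, Finset.mem_insert, hv]
          constructor
          · exact fun hu => (hmax u hu).eq_or_lt.imp id fun h => ⟨h, hu⟩
          · rintro (rfl | hu)
            · exact hv
            · exact hu.2
        rw [colorType, this, Finset.card_insert_of_notMem (by simp)]
        rfl
      have h3 : aboveCount lt κ v ≤ colorType κ a := by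
        refine Finset.card_le_card fun u hu => ?_
        simp only [Finset.mem_filter, Finset.mem_univ, true_and, hv] at hu ⊢
        exact Fin.ext (by omega)
      omega
  cases n with
  | zero => exact Subsingleton.antitone _
  | succ n => exact Fin.antitone_iff_succ_le.2 fun i => h _ _ (by simp)

theorem rowPos_lt_colorType (κ : V → Fin n) (v : V) : rowPos κ v < colorType κ (κ v) := by
  refine Finset.card_lt_card ⟨fun w hw => ?_, fun h => ?_⟩
  · simp only [Finset.mem_filter, Finset.mem_univ, true_and] at hw ⊢
    exact hw.2
  · have := h (Finset.mem_filter.2 ⟨Finset.mem_univ v, rfl⟩)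
    simp at this

theorem bijective_rowPos {κ : V → Fin n} (ha : Antitone (colorType κ)) :
    Function.Bijective fun v : V =>
      (⟨(κ v, rowPos κ v), (mem_rowDiagram ha).2 ⟨(κ v).2, rowPos_lt_colorType κ v⟩⟩ :
        {c : ℕ × ℕ // c ∈ rowDiagram (colorType κ)}) := by
  let _ : Fintype {c : ℕ × ℕ // c ∈ rowDiagram (colorType κ)} :=
    Fintype.subtype _ (YoungDiagram.mem_cells (μ := rowDiagram (colorType κ)))
  rw [Fintype.bijective_iff_injective_and_card]
  constructor
  · intro u v h
    simp only [Subtype.mk.injEq, Prod.mk.injEq, Fin.val_inj] at h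
    exact eq_of_rowPos_eq h.1 h.2
  · rw [Fintype.subtype_card, card_rowDiagram ha]
    exact Finset.card_eq_sum_card_fiberwise fun v _ => Finset.mem_coe.2 (Finset.mem_univ (κ v))

/-- The tableau with rows the color classes of a coloring without flaws. -/
noncomputable def PTableau.ofColoring (hP : IsNaturalUnitIntervalOrder lt) {κ : V → Fin n}
    (hκ : IsProper lt κ) (hg : ∀ v, ¬ IsFlaw lt κ v) : PTableau lt where
  shape := rowDiagram (colorType κ)
  entry := (Equiv.ofBijective _ (bijective_rowPos (colorType_antitone hg))).symm
  row c d h := by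
    obtain ⟨u, rfl⟩ := (bijective_rowPos (colorType_antitone hg)).2 c
    obtain ⟨v, rfl⟩ := (bijective_rowPos (colorType_antitone hg)).2 d
    rw [Equiv.ofBijective_symm_apply_apply, Equiv.ofBijective_symm_apply_apply]
    simp only [Prod.mk.injEq, Fin.val_inj] at h
    refine hκ.lt_of_eq ?_ h.1.symm
    by_contra hvu
    rcases (not_lt.1 hvu).eq_or_lt with rfl | h1
    · omega
    · have := rowPos_lt_rowPos h.1 h1
      omega
  col c d h hl := by
    obtain ⟨u, rfl⟩ := (bijective_rowPos (colorType_antitone hg)).2 c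
    obtain ⟨v, rfl⟩ := (bijective_rowPos (colorType_antitone hg)).2 d
    rw [Equiv.ofBijective_symm_apply_apply, Equiv.ofBijective_symm_apply_apply] at hl
    simp only [Prod.mk.injEq] at h
    -- If `v` were below `u` in `P`, every entry of the upper row not exceeding `v` would lie left
    -- of `u`. At most `rowPos κ u = rowPos κ v` entries do, so `v` would be a flaw.
    refine hg v ⟨by omega, ?_⟩
    rw [h.2]
    refine Finset.card_le_card fun w hw => ?_
    simp only [Finset.mem_filter, Finset.mem_univ, true_and] at hw ⊢
    refine ⟨?_, Fin.ext (by omega)⟩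
    by_contra huw
    exact hw.2 (hP.lt_of_lt_of_le hl (not_lt.1 huw))

/-! ### From a tableau back to the coloring by its rows -/

namespace PTableau

section

variable {V : Type*} {lt : V → V → Prop}

/-- The column of `T` in which `v` appears. -/
def colOf (T : PTableau lt) (v : V) : ℕ := (T.entry.symm v).1.2

theorem mem_shape (T : PTableau lt) (v : V) : (T.rowOf v, T.colOf v) ∈ T.shape :=
  (T.entry.symm v).2

theorem exists_of_mem_shape (T : PTableau lt) {i j : ℕ} (h : (i, j) ∈ T.shape) :
    ∃ v, T.rowOf v = i ∧ T.colOf v = j := by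
  refine ⟨T.entry ⟨(i, j), h⟩, ?_, ?_⟩ <;> simp [rowOf, colOf]

theorem eq_of_rowOf_colOf (T : PTableau lt) {u v : V} (h1 : T.rowOf u = T.rowOf v)
    (h2 : T.colOf u = T.colOf v) : u = v :=
  T.entry.symm.injective (Subtype.ext (Prod.ext h1 h2))

theorem lt_of_colOf_eq_succ (T : PTableau lt) {u v : V} (h1 : T.rowOf u = T.rowOf v)
    (h2 : T.colOf v = T.colOf u + 1) : lt u v := by
  have := T.row (T.entry.symm u) (T.entry.symm v) (Prod.ext h1.symm h2)
  rwa [Equiv.apply_symm_apply, Equiv.apply_symm_apply] at this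

theorem not_lt_of_rowOf_eq_succ (T : PTableau lt) {u v : V} (h1 : T.rowOf v = T.rowOf u + 1)
    (h2 : T.colOf v = T.colOf u) : ¬ lt v u := by
  have := T.col (T.entry.symm u) (T.entry.symm v) (Prod.ext h1 h2)
  rwa [Equiv.apply_symm_apply, Equiv.apply_symm_apply] at this

theorem ext_rowOf_colOf {T T' : PTableau lt} (h1 : ∀ v, T.rowOf v = T'.rowOf v)
    (h2 : ∀ v, T.colOf v = T'.colOf v) : T = T' := by
  have hμ : T.shape = T'.shape := by
    refine SetLike.ext fun ⟨i, j⟩ => ⟨fun h => ?_, fun h => ?_⟩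
    · obtain ⟨v, rfl, rfl⟩ := T.exists_of_mem_shape h
      rw [h1, h2]
      exact T'.mem_shape v
    · obtain ⟨v, rfl, rfl⟩ := T'.exists_of_mem_shape h
      rw [← h1, ← h2]
      exact T.mem_shape v
  obtain ⟨μ, e, r, c⟩ := T
  obtain ⟨μ', e', r', c'⟩ := T'
  obtain rfl : μ = μ' := hμ
  have he : e.symm = e'.symm := Equiv.ext fun v => Subtype.ext (Prod.ext (h1 v) (h2 v))
  obtain rfl : e = e' := by simpa using congrArg Equiv.symm he
  rfl

theorem lt_of_colOf_lt [LinearOrder V] (hP : IsNaturalUnitIntervalOrder lt) (T : PTableau lt) {u : V} :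
    ∀ {v : V}, T.rowOf u = T.rowOf v → T.colOf u < T.colOf v → lt u v := by
  suffices h : ∀ k v, T.rowOf u = T.rowOf v → T.colOf v = T.colOf u + k + 1 → lt u v from
    fun {v} h1 h2 => h (T.colOf v - T.colOf u - 1) v h1 (by omega)
  intro k
  induction k with
  | zero => exact fun v h1 h2 => T.lt_of_colOf_eq_succ h1 h2
  | succ k ih =>
    intro v h1 h2
    obtain ⟨w, hw1, hw2⟩ := T.exists_of_mem_shape
      (T.shape.up_left_mem le_rfl (Nat.le_of_lt (by omega : T.colOf u + k + 1 < T.colOf v))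
        (T.mem_shape v))
    exact hP.trans _ _ _ (ih w (h1.trans hw1.symm) hw2)
      (T.lt_of_colOf_eq_succ hw1 (by omega))

end

theorem colOf_lt_iff {V : Type*} [LinearOrder V] {lt : V → V → Prop}
    (hP : IsNaturalUnitIntervalOrder lt) (T : PTableau lt) {u v : V}
    (h : T.rowOf u = T.rowOf v) : T.colOf u < T.colOf v ↔ u < v := by
  constructor
  · exact fun h1 => hP.natural _ _ (T.lt_of_colOf_lt hP h h1)
  · intro huv
    rcases lt_trichotomy (T.colOf u) (T.colOf v) with h1 | h1 | h1
    · exact h1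
    · exact absurd (T.eq_of_rowOf_colOf h h1) huv.ne
    · exact absurd (hP.natural _ _ (T.lt_of_colOf_lt hP h.symm h1)) huv.not_gt

variable {T : PTableau lt}

/-- The coloring of the vertices by the rows of a tableau with at most `n` rows. -/
def rowColoring {V : Type*} {lt : V → V → Prop} (T : PTableau lt) (h : (n, 0) ∉ T.shape) (v : V) : Fin n :=
  ⟨T.rowOf v, by
    by_contra hv
    exact h (T.shape.up_left_mem (not_lt.1 hv) (Nat.zero_le _) (T.mem_shape v))⟩

variable (h : (n, 0) ∉ T.shape)

theorem rowColoring_eq_iff {V : Type*} {lt : V → V → Prop} {T : PTableau lt}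
    (h : (n, 0) ∉ T.shape) {u v : V} :
    T.rowColoring h u = T.rowColoring h v ↔ T.rowOf u = T.rowOf v := Fin.ext_iff

theorem isProper_rowColoring {V : Type*} [LinearOrder V] {lt : V → V → Prop} {T : PTableau lt}
    (h : (n, 0) ∉ T.shape) (hP : IsNaturalUnitIntervalOrder lt) :
    IsProper lt (T.rowColoring h) := by
  intro u v huv hl he
  rw [rowColoring_eq_iff] at he
  exact hl (T.lt_of_colOf_lt hP he ((T.colOf_lt_iff hP he).2 huv))

theorem rowPos_rowColoring (hP : IsNaturalUnitIntervalOrder lt) (v : V) :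
    rowPos (T.rowColoring h) v = T.colOf v := by
  rw [← Finset.card_range (T.colOf v)]
  refine Finset.card_bij (fun u _ => T.colOf u) ?_ ?_ ?_
  · intro u hu
    simp only [Finset.mem_filter, Finset.mem_univ, true_and, rowColoring_eq_iff] at hu
    exact Finset.mem_range.2 ((T.colOf_lt_iff hP hu.2).2 hu.1)
  · intro u hu w hw he
    simp only [Finset.mem_filter, Finset.mem_univ, true_and, rowColoring_eq_iff] at hu hw
    exact T.eq_of_rowOf_colOf (hu.2.trans hw.2.symm) he
  · intro j hj
    rw [Finset.mem_range] at hj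
    obtain ⟨u, hu1, hu2⟩ :=
      T.exists_of_mem_shape (T.shape.up_left_mem le_rfl hj.le (T.mem_shape v))
    refine ⟨u, ?_, hu2⟩
    simp only [Finset.mem_filter, Finset.mem_univ, true_and, rowColoring_eq_iff]
    exact ⟨(T.colOf_lt_iff hP hu1).1 (hu2.trans_lt hj), hu1⟩

theorem colorType_rowColoring {V : Type*} [Fintype V] {lt : V → V → Prop} {T : PTableau lt}
    (h : (n, 0) ∉ T.shape) (i : Fin n) :
    colorType (T.rowColoring h) i = T.shape.rowLen i := by
  rw [← Finset.card_range (T.shape.rowLen i)]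
  refine Finset.card_bij (fun u _ => T.colOf u) ?_ ?_ ?_
  · intro u hu
    simp only [Finset.mem_filter, Finset.mem_univ, true_and, Fin.ext_iff] at hu
    rw [Finset.mem_range, ← YoungDiagram.mem_iff_lt_rowLen, ← hu]
    exact T.mem_shape u
  · intro u hu w hw he
    simp only [Finset.mem_filter, Finset.mem_univ, true_and, Fin.ext_iff] at hu hw
    exact T.eq_of_rowOf_colOf (hu.trans hw.symm) he
  · intro j hj
    rw [Finset.mem_range, ← YoungDiagram.mem_iff_lt_rowLen] at hj
    obtain ⟨u, hu1, hu2⟩ := T.exists_of_mem_shape hj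
    exact ⟨u, Finset.mem_filter.2 ⟨Finset.mem_univ u, Fin.ext hu1⟩, hu2⟩

theorem rowDiagram_colorType_rowColoring {V : Type*} [Fintype V] {lt : V → V → Prop}
    {T : PTableau lt} (h : (n, 0) ∉ T.shape) :
    Antitone (colorType (T.rowColoring h)) ∧
      rowDiagram (colorType (T.rowColoring h)) = T.shape := by
  have ha : Antitone (colorType (T.rowColoring h)) := by
    intro i j hij
    rw [colorType_rowColoring, colorType_rowColoring]
    exact T.shape.rowLen_anti _ _ hij
  refine ⟨ha, SetLike.ext fun ⟨i, j⟩ => ?_⟩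
  rw [mem_rowDiagram ha]
  constructor
  · rintro ⟨hi, hj⟩
    rw [colorType_rowColoring] at hj
    exact YoungDiagram.mem_iff_lt_rowLen.2 hj
  · intro hij
    refine ⟨?_, ?_⟩
    · by_contra hi
      exact h (T.shape.up_left_mem (not_lt.1 hi) (Nat.zero_le _) hij)
    · rw [colorType_rowColoring]
      exact YoungDiagram.mem_iff_lt_rowLen.1 hij

/-- The entry `w` directly above `v` does not exceed `v` in `P`, and neither do the entries to its
left. Together they outnumber the entries left of `v` by one. -/
theorem not_isFlaw_rowColoring (hP : IsNaturalUnitIntervalOrder lt) (v : V) :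
    ¬ IsFlaw lt (T.rowColoring h) v := by
  rintro ⟨h0, hle⟩
  change T.rowOf v ≠ 0 at h0
  obtain ⟨w, hw1, hw2⟩ := T.exists_of_mem_shape
    (T.shape.up_left_mem (Nat.sub_le (T.rowOf v) 1) le_rfl (T.mem_shape v))
  have hlt : ¬ lt v w := T.not_lt_of_rowOf_eq_succ (by omega) hw2.symm
  rw [rowPos_rowColoring h hP, ← hw2, ← rowPos_rowColoring h hP] at hle
  have hsub : insert w (Finset.univ.filter fun u =>
      u < w ∧ T.rowColoring h u = T.rowColoring h w) ⊆
      Finset.univ.filter fun u => u ≤ w ∧ T.rowOf u = T.rowOf w := by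
    intro u hu
    simp only [Finset.mem_filter, Finset.mem_univ, true_and, Finset.mem_insert,
      rowColoring_eq_iff] at hu ⊢
    rcases hu with rfl | hu
    · exact ⟨le_rfl, rfl⟩
    · exact ⟨hu.1.le, hu.2⟩
  have h1 := Finset.card_le_card hsub
  rw [Finset.card_insert_of_notMem (by simp)] at h1
  change rowPos (T.rowColoring h) w + 1 ≤ _ at h1
  have h2 : (Finset.univ.filter fun u => u ≤ w ∧ T.rowOf u = T.rowOf w).card ≤
      aboveCount lt (T.rowColoring h) v := by
    refine Finset.card_le_card fun u hu => ?_
    simp only [Finset.mem_filter, Finset.mem_univ, true_and] at hu ⊢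
    refine ⟨?_, fun hl => hlt (hP.lt_of_lt_of_le hl hu.1)⟩
    change T.rowOf u + 1 = T.rowOf v
    omega
  omega

theorem des_rowColoring (hP : IsNaturalUnitIntervalOrder lt) :
    des lt (T.rowColoring h) = T.inv := by
  unfold des inv
  congr 1
  ext ⟨u, v⟩
  simp only [Finset.mem_filter, Finset.mem_univ, true_and]
  constructor
  · exact fun ⟨h1, h2, h3⟩ => ⟨(hP.incomp_iff h1).2 h2, h1, h3⟩
  · exact fun ⟨h1, h2, h3⟩ => ⟨h2, (hP.incomp_iff h2).1 h1, h3⟩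

end PTableau

variable {R : Type*} [CommRing R]

-- Tableaux with more than `n` rows contribute zero by `schurPoly_eq_zero`. The others correspond to
-- the flawless colorings, and the bialternant formula rewrites their alternants.
open Classical in
theorem sum_flawless_eq (hP : IsNaturalUnitIntervalOrder lt) (t : R) (x : ℕ → R) :
    ∑ κ ∈ (properColorings lt n).filter (fun κ => ¬ ∃ v, IsFlaw lt κ v),
        t ^ des lt κ * alternant x (colorType κ) =
      alternant x (0 : Fin n → ℕ) * ∑ T : PTableau lt, t ^ T.inv * schurPoly n T.shape x := by
  have hzero : ∑ T : PTableau lt, t ^ T.inv * schurPoly n T.shape x =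
      ∑ T ∈ Finset.univ.filter (fun T : PTableau lt => (n, 0) ∉ T.shape),
        t ^ T.inv * schurPoly n T.shape x := by
    symm
    refine Finset.sum_filter_of_ne fun T _ hT h => hT ?_
    rw [schurPoly_eq_zero h, mul_zero]
  rw [hzero, Finset.mul_sum]
  symm
  refine Finset.sum_bij (fun T hT => T.rowColoring (Finset.mem_filter.1 hT).2) ?_ ?_ ?_ ?_
  · intro T hT
    have h := (Finset.mem_filter.1 hT).2
    rw [Finset.mem_filter, mem_properColorings]
    exact ⟨T.isProper_rowColoring h hP, fun ⟨v, hv⟩ => T.not_isFlaw_rowColoring h hP v hv⟩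
  · intro T hT T' hT' he
    refine PTableau.ext_rowOf_colOf (fun v => congrArg Fin.val (congrFun he v)) fun v => ?_
    rw [← PTableau.rowPos_rowColoring (Finset.mem_filter.1 hT).2 hP, he,
      PTableau.rowPos_rowColoring (Finset.mem_filter.1 hT').2 hP]
  · intro κ hκ
    rw [Finset.mem_filter, mem_properColorings, not_exists] at hκ
    refine ⟨PTableau.ofColoring hP hκ.1 hκ.2, Finset.mem_filter.2 ⟨Finset.mem_univ _, ?_⟩, ?_⟩
    · intro h
      obtain ⟨h1, _⟩ := (mem_rowDiagram (colorType_antitone hκ.2)).1 h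
      exact lt_irrefl _ h1
    · rfl
  · intro T hT
    have h := (Finset.mem_filter.1 hT).2
    obtain ⟨ha, hs⟩ := PTableau.rowDiagram_colorType_rowColoring h
    rw [PTableau.des_rowColoring h hP, alternant_eq_mul_schurPoly ha, hs]
    ring

theorem alternant_zero_ne_zero [IsDomain R] {x : ℕ → R} (hx : Function.Injective x) :
    alternant x (0 : Fin n → ℕ) ≠ 0 := by
  rw [alternant_eq_det_rev]
  have : (Matrix.of fun i j : Fin n => x i.rev ^ ((0 : Fin n → ℕ) j.rev + j)) =
      Matrix.vandermonde fun i : Fin n => x i.rev := by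
    ext i j
    simp [Matrix.vandermonde_apply]
  rw [this, Matrix.det_vandermonde_ne_zero_iff]
  exact fun i j h => Fin.rev_injective (Fin.val_injective (hx h))

/-- The Schur expansion in finitely many variables. -/
theorem desSum_eq_sum_schurPoly [IsDomain R] [CharZero R] (hP : IsNaturalUnitIntervalOrder lt)
    (t : R) {x : ℕ → R} (hx : Function.Injective x) :
    desSum lt t (fun i : Fin n => x i) = ∑ T : PTableau lt, t ^ T.inv * schurPoly n T.shape x := by
  classical
  refine mul_left_cancel₀ (alternant_zero_ne_zero (n := n) hx) ?_
  rw [alternant_zero_mul_desSum hP, ← sum_flawless_eq hP,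
    ← Finset.sum_filter_add_sum_filter_not _ (fun κ => ∃ v, IsFlaw lt κ v),
    sum_exists_flaw_eq_zero hP, zero_add]

theorem asc_eq_des_rev (hP : IsNaturalUnitIntervalOrder lt) (κ : V → Fin n) :
    asc (incGraph lt) (fun v => (κ v : ℕ).succPNat) = des lt fun v => (κ v).rev := by
  unfold des asc
  congr 1
  ext ⟨u, v⟩
  simp only [Finset.mem_filter, Finset.mem_univ, true_and, Fin.rev_lt_rev,
    Nat.succPNat_lt_succPNat, Fin.val_fin_lt]
  constructor
  · exact fun ⟨h1, h2, h3⟩ => ⟨h2, (hP.incomp_iff h2).1 h1, h3⟩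
  · exact fun ⟨h1, h2, h3⟩ => ⟨(hP.incomp_iff h1).2 h2, h1, h3⟩

/-- Color reversal exchanges ascents and descents at the cost of reversing the variables, which
symmetry undoes. -/
theorem sum_asc_eq_desSum (hP : IsNaturalUnitIntervalOrder lt) (t : R) (y : Fin n → R) :
    ∑ κ ∈ properColorings lt n, t ^ asc (incGraph lt) (fun v => (κ v : ℕ).succPNat) *
      ∏ v, y (κ v) = desSum lt t y := by
  rw [← desSum_comp_perm hP t Fin.revPerm]
  refine Finset.sum_bij' (fun κ _ v => (κ v).rev) (fun κ _ v => (κ v).rev) ?_ ?_ ?_ ?_ ?_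
  · exact fun κ hκ => mem_properColorings.2 fun u v huv hl h =>
      mem_properColorings.1 hκ u v huv hl (Fin.rev_injective h)
  · exact fun κ hκ => mem_properColorings.2 fun u v huv hl h =>
      mem_properColorings.1 hκ u v huv hl (Fin.rev_injective h)
  · exact fun κ _ => funext fun v => Fin.rev_rev _
  · exact fun κ _ => funext fun v => Fin.rev_rev _
  · intro κ _
    rw [asc_eq_des_rev hP]
    simp

end Tableaux

/-! ### Formal power series -/

section PowerSeries

theorem coeff_formalSum {ι R : Type*} [CommRing R] (f : ι → MvPowerSeries ℕ+ R) (m : ℕ+ →₀ ℕ) :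
    MvPowerSeries.coeff m (formalSum f) = ∑ᶠ i, MvPowerSeries.coeff m (f i) := rfl

theorem exists_natPred_lt (m : ℕ+ →₀ ℕ) : ∃ n, ∀ p ∈ m.support, p.natPred < n :=
  ⟨m.support.sup PNat.natPred + 1, fun _ hp => Nat.lt_succ_of_le (Finset.le_sup hp)⟩

/-- A tableau contributing to the monomial `m` has all its entries among the variables of `m`, so
the infinite sum may be truncated. -/
theorem coeff_schur {μ : YoungDiagram} {m : ℕ+ →₀ ℕ} {n : ℕ}
    (hn : ∀ p ∈ m.support, p.natPred < n) :
    MvPowerSeries.coeff m (schur μ) = MvPowerSeries.coeff m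
      (schurPoly n μ fun i => (MvPowerSeries.X i.succPNat : MvPowerSeries ℕ+ ℤ)) := by
  rw [schur, coeff_formalSum, finsum_eq_finsetSum_of_support_subset _ (s := ssytLT n μ),
    schurPoly, map_sum]
  · rfl
  · intro T hT
    rw [Finset.mem_coe, mem_ssytLT]
    intro c hc
    have := hn _ (mem_support_of_coeff_ne_zero μ.cells (fun c => (T c.1 c.2).succPNat) (1 : ℤ) m
      (by rw [map_one, one_mul]; exact hT) c hc)
    rwa [Nat.natPred_succPNat] at this

theorem map_schurPoly {R S : Type*} [CommRing R] [CommRing S] (f : R →+* S) (n : ℕ)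
    (μ : YoungDiagram) (x : ℕ → R) : f (schurPoly n μ x) = schurPoly n μ fun i => f (x i) := by
  simp [schurPoly, map_sum, map_prod]

variable {V : Type*} [LinearOrder V] [Fintype V] {lt : V → V → Prop}

theorem coeff_chromaticQuasisymmetric (hP : IsNaturalUnitIntervalOrder lt) {m : ℕ+ →₀ ℕ} {n : ℕ}
    (hn : ∀ p ∈ m.support, p.natPred < n) :
    MvPowerSeries.coeff m (chromaticQuasisymmetric (incGraph lt)) =
      MvPowerSeries.coeff m (∑ κ ∈ properColorings lt n,
        MvPowerSeries.C (Polynomial.X : Polynomial ℤ) ^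
          asc (incGraph lt) (fun v => (κ v : ℕ).succPNat) *
        ∏ v, MvPowerSeries.X (κ v : ℕ).succPNat) := by
  classical
  let φ : {κ // κ ∈ properColorings lt n} → (incGraph lt).Coloring ℕ+ := fun κ =>
    SimpleGraph.Coloring.mk (fun v => (κ.1 v : ℕ).succPNat) (by
      intro u v huv he
      have he' : κ.1 u = κ.1 v := Fin.val_injective (Nat.succPNat_injective he)
      rcases lt_or_gt_of_ne huv.1 with h | h
      · exact mem_properColorings.1 κ.2 u v h huv.2.1 he'
      · exact mem_properColorings.1 κ.2 v u h huv.2.2 he'.symm)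
  have hφ : Function.Injective φ := by
    intro κ κ' h
    refine Subtype.ext (funext fun v => ?_)
    exact Fin.val_injective (Nat.succPNat_injective (DFunLike.congr_fun h v))
  rw [chromaticQuasisymmetric, coeff_formalSum, finsum_eq_finsetSum_of_support_subset _
    (s := (properColorings lt n).attach.map ⟨φ, hφ⟩), Finset.sum_map, map_sum,
    ← Finset.sum_attach (properColorings lt n)]
  · refine Finset.sum_congr rfl fun κ _ => ?_
    rw [coloringTerm, map_pow]
    rfl
  · intro κ hκ
    have hlt : ∀ v, (κ v).natPred < n := fun v => hn _
      (mem_support_of_coeff_ne_zero Finset.univ (fun v => κ v) _ m hκ v (Finset.mem_univ v))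
    rw [Finset.mem_coe, Finset.mem_map]
    refine ⟨⟨fun v => ⟨(κ v).natPred, hlt v⟩, mem_properColorings.2 fun u v huv hl he => ?_⟩,
      Finset.mem_attach _ _, ?_⟩
    · have h1 : κ u ≠ κ v := κ.valid ((hP.incomp_iff huv).2 hl)
      simp only [Fin.mk.injEq] at he
      exact h1 (PNat.natPred_injective he)
    · refine DFunLike.ext _ _ fun v => ?_
      exact PNat.succPNat_natPred (κ v)

theorem chromaticQuasisymmetric_eq (hP : IsNaturalUnitIntervalOrder lt) :
    chromaticQuasisymmetric (incGraph lt) = ∑ T : PTableau lt,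
      MvPowerSeries.C (Polynomial.X ^ T.inv) *
        MvPowerSeries.map Polynomial.C (schur T.shape) := by
  have : IsDomain (MvPowerSeries ℕ+ (Polynomial ℤ)) := NoZeroDivisors.to_isDomain _
  have : CharZero (MvPowerSeries ℕ+ (Polynomial ℤ)) :=
    charZero_of_injective_ringHom (MvPowerSeries.C_injective (σ := ℕ+) (R := Polynomial ℤ))
  ext1 m
  obtain ⟨n, hn⟩ := exists_natPred_lt m
  have hx : Function.Injective fun i : ℕ =>
      (MvPowerSeries.X i.succPNat : MvPowerSeries ℕ+ (Polynomial ℤ)) := fun i j h =>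
    Nat.succPNat_injective (MvPowerSeries.X_inj.1 h)
  -- The finite expansion is applied inside the power series ring itself, a domain of characteristic
  -- zero, with the distinct variables as the `x_i` and `n` chosen to cover the monomial `m`.
  rw [coeff_chromaticQuasisymmetric hP hn, sum_asc_eq_desSum hP (MvPowerSeries.C Polynomial.X)
    (fun i : Fin n => (MvPowerSeries.X (i : ℕ).succPNat : MvPowerSeries ℕ+ (Polynomial ℤ))),
    desSum_eq_sum_schurPoly hP _ hx, map_sum, map_sum]
  refine Finset.sum_congr rfl fun T _ => ?_
  rw [← map_pow, MvPowerSeries.coeff_C_mul, MvPowerSeries.coeff_C_mul, MvPowerSeries.coeff_map,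
    coeff_schur hn, ← MvPowerSeries.coeff_map, map_schurPoly]
  simp only [MvPowerSeries.map_X]

theorem tCoeff_sum {ι : Type*} (s : Finset ι) (j : ℕ) (d : ι → ℕ) (f : ι → MvPowerSeries ℕ+ ℤ) :
    tCoeff j (∑ i ∈ s, MvPowerSeries.C (Polynomial.X ^ d i) *
      MvPowerSeries.map Polynomial.C (f i)) = ∑ i ∈ s.filter fun i => d i = j, f i := by
  ext m
  change Polynomial.coeff (MvPowerSeries.coeff m _) j = _
  rw [map_sum, map_sum, Polynomial.finsetSum_coeff, Finset.sum_filter]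
  refine Finset.sum_congr rfl fun i _ => ?_
  rw [MvPowerSeries.coeff_C_mul, MvPowerSeries.coeff_map, Polynomial.coeff_mul_C,
    Polynomial.coeff_X_pow]
  by_cases h : d i = j
  · simp [h]
  · simp [h, Ne.symm h]

theorem schurPositive_sum {ι : Type*} (s : Finset ι) (μ : ι → YoungDiagram) :
    SchurPositive (∑ i ∈ s, schur (μ i)) := by
  classical
  refine ⟨∑ i ∈ s, Finsupp.single (μ i) 1, fun ν => ?_, ?_⟩
  · rw [Finsupp.finsetSum_apply]
    refine Finset.sum_nonneg fun i _ => ?_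
    rw [Finsupp.single_apply]
    split_ifs <;> simp
  · rw [← Finsupp.sum_finsetSum_index (by simp) (by simp [add_smul])]
    simp

end PowerSeries

end ChromaticQuasi

theorem theorem6p3 (S : Finset ℕ+) (lt : S → S → Prop)
    (hP : ChromaticQuasi.IsNaturalUnitIntervalOrder lt) :
    ChromaticQuasi.chromaticQuasisymmetric (ChromaticQuasi.incGraph lt) =
        ∑ T : ChromaticQuasi.PTableau lt,
          MvPowerSeries.C (Polynomial.X ^ T.inv) *
            MvPowerSeries.map Polynomial.C (ChromaticQuasi.schur T.shape) ∧
      ∀ j : ℕ, ChromaticQuasi.SchurPositive (ChromaticQuasi.tCoeff j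
        (ChromaticQuasi.chromaticQuasisymmetric (ChromaticQuasi.incGraph lt))) := by
  refine ⟨ChromaticQuasi.chromaticQuasisymmetric_eq hP, fun j => ?_⟩
  rw [ChromaticQuasi.chromaticQuasisymmetric_eq hP, ChromaticQuasi.tCoeff_sum]
  exact ChromaticQuasi.schurPositive_sum _ _
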